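/- All trees may be infinite, and the empty tree counts as a tree. A tree $T$ is \emph{scattered} if no subdivision of the binary tree $\mathrm{T}_2$ (whose vertices are the finite $0$-$1$-sequences, each sequence $s$ being adjacent to $s0$ and $s1$) is embeddable into $T$ as a subtree. A \emph{ray} of $T$ is a one-way infinite path of $T$; two rays are equivalent if they coincide outside some finite set of vertices, and the equivalence classes are the \emph{ends} of $T$. The set $\Omega(T)$ of ends carries the topology generated by the sets $\Omega_{r,s}$ ($r,s\in V(T)$), where $\Omega_{r,s}$ is the set of ends containing a ray that starts at $r$ and passes through $s$. (For any fixed vertex $r$, the sets $\Omega_{r,s}$, $s \in V(T)$, already form a basis of it.) A topological space is \emph{topologically scattered} if every nonempty subset $S$ has a point that is isolated in $S$. Consider the following operations on rooted trees, where the empty tree $\Box$ is allowed and rooted trees are considered up to isomorphism. The \emph{successor} $1+T$ is obtained from $T$ by adding a new vertex joined to the root of $T$ (if $T \neq \Box$) and taking it as the new root. The \emph{sup} $\bigvee_{i\in I}T_i$ is obtained from disjoint copies of the $T_i$ by identifying all their roots. The \emph{sum} $\bigoplus_{n\in\mathbb{N}}T_n$ of a sequence in which every term after an empty one is empty is obtained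 from disjoint copies of the $T_n$ by joining, for every $n$ such that $T_{n+1}$ is nonempty, the root of $T_n$ to the root of $T_{n+1}$, and taking the root of $T_0$ as the root. For a class $\mathcal{X}$ of rooted trees let $\mathcal{X}^{\mathrm{suc},\sup}$ be the smallest class of rooted trees that contains $\mathcal{X}$ and is closed under successors and sups, and let $\bigoplus_{n\in\mathbb{N}}\mathcal{X}$ be the class of all sums $\bigoplus_{n\in\mathbb{N}}T_n$ with all $T_n\in\mathcal{X}$. Define by transfinite recursion $\mathcal{D}_r^{(0)}=\{\Box\}^{\mathrm{suc},\sup}$, $\mathcal{D}_r^{(\beta+1)}=\bigl(\bigoplus_{n\in\mathbb{N}}\mathcal{D}_r^{(\beta)}\bigr)^{\mathrm{suc},\sup}$, and $\mathcal{D}_r^{(\alpha)}=\bigl(\bigcup_{\beta<\alpha}\mathcal{D}_r^{(\beta)}\bigr)^{\mathrm{suc},\sup}$ for every nonzero limit ordinal $\alpha$. Let $\mathcal{D}$ be the class of trees obtained by forgetting the roots of the members of $\bigcup_{\alpha}\mathcal{D}_r^{(\alpha)}$. Theorem. For every tree $T$ the following are equivalent: (i) $T$ is scattered; (ii) $\Omega(T)$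 is topologically scattered; (iii) $T\in\mathcal{D}$. -/

import Mathlib

universe u v w

namespace ScatteredTrees

/-! ## Subdivisions and scattered trees -/

/-- `Subdivision G H` exhibits `H` as a subdivision of `G`: every edge `uv` of `G` is replaced by
a path of `H` between the branch vertices of `u` and `v`, distinct edges are replaced by internally
disjoint paths whose inner vertices are not branch vertices, and `H` has no other vertices or
edges. -/
structure Subdivision {V : Type v} {W : Type w} (G : SimpleGraph V) (H : SimpleGraph W) where
  branch : V → W
  branch_injective : Function.Injective branch
  path : ∀ u v : V, G.Adj u v → H.Walk (branch u) (branch v)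
  path_isPath : ∀ u v (h : G.Adj u v), (path u v h).IsPath
  path_symm : ∀ u v (h : G.Adj u v), path v u h.symm = (path u v h).reverse
  branch_mem : ∀ u v (h : G.Adj u v) (x : V),
    branch x ∈ (path u v h).support → x = u ∨ x = v
  disjoint : ∀ u v (h : G.Adj u v) u' v' (h' : G.Adj u' v') (x : W),
    s(u, v) ≠ s(u', v') → x ∈ (path u v h).support → x ∈ (path u' v' h').support →
      x = branch u ∨ x = branch v
  vertex_cover : ∀ x : W,
    (∃ v, x = branch v) ∨ ∃ u v, ∃ h : G.Adj u v, x ∈ (path u v h).support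
  edge_cover : ∀ x y : W, H.Adj x y → ∃ u v, ∃ h : G.Adj u v, s(x, y) ∈ (path u v h).edges

/-- The binary tree: the vertices are the finite `0`-`1`-sequences, and the edges join each
sequence `s` to the sequences obtained by adding one entry on the right of `s`. -/
def binaryTree : SimpleGraph (List Bool) :=
  SimpleGraph.fromRel (fun s t => ∃ b : Bool, t = s ++ [b])

/-- No subdivision of the binary tree is embeddable into `T`. (The universe of `W` is no
restriction: a graph that embeds into `T` is isomorphic to a graph on a subset of `V`.) -/
def IsScattered {V : Type u} (T : SimpleGraph V) : Prop :=
  ∀ (W : Type u) (H : SimpleGraph W), Nonempty (Subdivision binaryTree H) → IsEmpty (H ↪g T)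

/-! ## The space of ends -/

/-- A ray, that is, a one-way infinite path, enumerated from its origin. -/
structure Ray {V : Type u} (T : SimpleGraph V) where
  vertex : ℕ → V
  injective : Function.Injective vertex
  adj : ∀ n, T.Adj (vertex n) (vertex (n + 1))

/-- The set of vertices of a ray. -/
def Ray.verts {V : Type u} {T : SimpleGraph V} (C : Ray T) : Set V := Set.range C.vertex

/-- Two rays are equivalent if they coincide outside some finite set of vertices. -/
def rayEquivalence {V : Type u} (T : SimpleGraph V) : Setoid (Ray T) where
  r C C' := ∃ F : Set V, F.Finite ∧ C.verts \ F = C'.verts \ F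
  iseqv :=
    { refl := fun _ => ⟨∅, Set.finite_empty, rfl⟩
      symm := fun ⟨F, hF, h⟩ => ⟨F, hF, h.symm⟩
      trans := fun ⟨F, hF, h⟩ ⟨F', hF', h'⟩ =>
        ⟨F ∪ F', hF.union hF', by
          rw [← Set.sdiff_sdiff, h, Set.sdiff_sdiff, Set.union_comm, ← Set.sdiff_sdiff, h',
            Set.sdiff_sdiff]⟩ }

/-- The ends of `T` are the equivalence classes of rays. -/
def Ends {V : Type u} (T : SimpleGraph V) : Type u := Quotient (rayEquivalence T)

/-- The end that contains a given ray. -/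
def Ray.toEnd {V : Type u} {T : SimpleGraph V} (C : Ray T) : Ends T :=
  Quotient.mk (rayEquivalence T) C

/-- The set of ends that contain a ray with origin `r` that passes through `s`. -/
def endsThrough {V : Type u} (T : SimpleGraph V) (r s : V) : Set (Ends T) :=
  {e | ∃ C : Ray T, C.toEnd = e ∧ C.vertex 0 = r ∧ s ∈ C.verts}

/-- The topology on the ends. When `T` is a tree, the sets `endsThrough T r s` with `r` fixed form
a basis of a topology that does not depend on `r`; this is the topology here. -/
instance endsTopology {V : Type u} (T : SimpleGraph V) : TopologicalSpace (Ends T) :=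
  TopologicalSpace.generateFrom {U | ∃ r s : V, U = endsThrough T r s}

/-- Every nonempty subset has a point that is isolated in it. -/
def TopologicallyScattered (X : Type u) [TopologicalSpace X] : Prop :=
  ∀ S : Set X, S.Nonempty → ∃ x ∈ S, ∃ U : Set X, IsOpen U ∧ U ∩ S = {x}

/-! ## Rooted trees and operations on them -/

/-- A rooted tree, possibly the empty tree; only the empty tree has no root. -/
structure RootedTree : Type (u + 1) where
  V : Type u
  graph : SimpleGraph V
  preconnected : graph.Preconnected
  isAcyclic : graph.IsAcyclic
  root : Option V
  isEmpty_of_root_eq_none : root = none → IsEmpty V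

/-- `T = 1 + T'` (up to isomorphism): `T` is obtained from `T'` by adding a new vertex `a`, joined
to the root of `T'` if there is one and to nothing else, and by choosing `a` as the root. -/
def IsSuc (T T' : RootedTree.{u}) : Prop :=
  ∃ (a : T.V) (e : T'.graph ↪g T.graph),
    T.root = some a ∧
    (∀ y, e y ≠ a) ∧
    (∀ x, x = a ∨ ∃ y, e y = x) ∧
    (∀ y, T.graph.Adj a (e y) ↔ T'.root = some y)

/-- `T = ⋁ i, F i` (up to isomorphism): `T` is obtained from disjoint copies of the `F i` by
identifying all their roots to a single one, the root of `T`. -/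
def IsSup (T : RootedTree.{u}) {I : Type u} (F : I → RootedTree.{u}) : Prop :=
  ∃ e : ∀ i, (F i).graph ↪g T.graph,
    (∀ i y, (F i).root = some y → T.root = some (e i y)) ∧
    (∀ x, ∃ i y, e i y = x) ∧
    (∀ i j y z, i ≠ j → e i y = e j z → T.root = some (e i y)) ∧
    (∀ x x', T.graph.Adj x x' → ∃ i y y', e i y = x ∧ e i y' = x')

/-- `T = ⨁ n, F n` (up to isomorphism): `T` is obtained from disjoint copies of the `F n` by joining
the roots of `F n` and `F (n + 1)` for all `n`, and its root is that of `F 0`. The `F n` may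
be empty from some index on, in which case this is a sum over a finite path. -/
def IsPathSum (T : RootedTree.{u}) (F : ℕ → RootedTree.{u}) : Prop :=
  (∀ n, IsEmpty (F n).V → IsEmpty (F (n + 1)).V) ∧
  ∃ e : ∀ n, (F n).graph ↪g T.graph,
    T.root = (F 0).root.map (e 0) ∧
    (∀ x, ∃ n y, e n y = x) ∧
    (∀ m n y z, m ≠ n → e m y ≠ e n z) ∧
    (∀ m n y z, m ≠ n → (T.graph.Adj (e m y) (e n z) ↔
      (n = m + 1 ∨ m = n + 1) ∧ (F m).root = some y ∧ (F n).root = some z))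

/-- The smallest class of rooted trees that contains `X` and is closed under successors and
suprema. -/
inductive SucSupClosure (X : Set RootedTree.{u}) : RootedTree.{u} → Prop
  | base (T : RootedTree.{u}) : T ∈ X → SucSupClosure X T
  | suc (T T' : RootedTree.{u}) : IsSuc T T' → SucSupClosure X T' → SucSupClosure X T
  | sup (T : RootedTree.{u}) (I : Type u) (F : I → RootedTree.{u}) :
      IsSup T F → (∀ i, SucSupClosure X (F i)) → SucSupClosure X T

/-- The class of all sums over `ℕ` of sequences of members of `X`. -/
def pathSums (X : Set RootedTree.{u}) : Set RootedTree.{u} :=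
  {T | ∃ F : ℕ → RootedTree.{u}, (∀ n, F n ∈ X) ∧ IsPathSum T F}

/-- The classes of rooted trees obtained by transfinite recursion: the closure of the empty tree at
`0`, the closure of the sums over `ℕ` of members of the previous class at successors, and the
closure of the union of the previous classes at limits. -/
noncomputable def rootedClass (α : Ordinal.{u}) : Set RootedTree.{u} :=
  Ordinal.limitRecOn α
    {T | SucSupClosure {T' | IsEmpty T'.V} T}
    (fun _ X => {T | SucSupClosure (pathSums X) T})
    (fun α _ X => {T | SucSupClosure {T' | ∃ β, ∃ h : β < α, T' ∈ X β h} T})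

theorem rootedClass_zero :
    rootedClass.{u} 0 = {T | SucSupClosure {T' | IsEmpty T'.V} T} := by
  simp only [rootedClass, Ordinal.limitRecOn_zero]

theorem rootedClass_add_one (β : Ordinal.{u}) :
    rootedClass (β + 1) = {T | SucSupClosure (pathSums (rootedClass β)) T} := by
  simp only [rootedClass, Ordinal.limitRecOn_add_one]

theorem rootedClass_limit (α : Ordinal.{u}) (h : Order.IsSuccLimit α) :
    rootedClass α = {T | SucSupClosure {T' | ∃ β < α, T' ∈ rootedClass β} T} := by
  simp only [rootedClass, Ordinal.limitRecOn_limit _ _ _ _ h, exists_prop]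

/-- `T` is, up to isomorphism, obtained from a member of one of the classes `rootedClass α` by
forgetting the root. -/
def InClassD {V : Type u} (T : SimpleGraph V) : Prop :=
  ∃ (α : Ordinal.{u}) (R : RootedTree.{u}), R ∈ rootedClass α ∧ Nonempty (R.graph ≃g T)

end ScatteredTrees

/-! Fix a root `r` and order the vertices by `Below`. All three conditions turn out to say that
there is no `Branching` set: no nonempty set in which every member lies below two incomparable
members.

Scattered. In an embedded subdivision of the binary tree, at most one of the paths at a branch
vertex can lead down towards the root. Hence the order of sequences agrees with the tree order on
one half of the binary tree, whose branch vertices form a branching set (`Subdivision.branching`).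
Conversely, the points where members of a branching set part give a `BinaryMap`, and the convex hull
of its image is a subdivision.

Ends. Every end has exactly one ray from `r`, as a vertex set. If a nonempty set of ends has no
isolated point, the vertices on its rays from `r` form a branching set. Conversely, for a branching
set the ends whose rays stay in its downward closure have no isolated point.

The class. In a successor, sup or sum, the roots of the parts form a chain together with the new
root. A branching set must leave this chain, and everything above a vertex off the chain stays
inside one part, so that part has a branching set (`not_branching_of_attached`). Conversely, call
`v` bad if the tree above `v` lies in no class. If there are bad vertices and no branching set, the
bad vertices above some bad `b` form a chain. A maximal bad vertex is impossible, because its tree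
is a sup of successors of good trees. So a path climbs from `b` for ever, and the tree above `b` is
the sum along this path of trees built from good ones: `b` is not bad after all
(`exists_treeAbove_mem_rootedClass`). -/

namespace ScatteredTrees

open SimpleGraph

/-! ## The order of a rooted tree -/

/-- Every walk from the root `r` to `y` passes through `x`. In a tree with root `r` this is the
tree order. -/
def Below {V : Type u} (T : SimpleGraph V) (r x y : V) : Prop :=
  ∀ p : T.Walk r y, x ∈ p.support

theorem eq_of_mem_takeUntil_of_mem_dropUntil {V : Type u} [DecidableEq V] {T : SimpleGraph V}
    {a b x y : V} {p : T.Walk a b} (hp : p.IsPath) (hx : x ∈ p.support)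
    (h₁ : y ∈ (p.takeUntil x hx).support) (h₂ : y ∈ (p.dropUntil x hx).support) : y = x := by
  have hn := hp.support_nodup
  rw [← p.take_spec hx, Walk.support_append, List.nodup_append'] at hn
  rw [← Walk.cons_tail_support, List.mem_cons] at h₂
  exact h₂.resolve_right fun h => hn.2.2 h₁ h

theorem eq_of_isPath {V : Type u} {T : SimpleGraph V} (ha : T.IsAcyclic) {a b : V}
    {p q : T.Walk a b} (hp : p.IsPath) (hq : q.IsPath) : p = q :=
  congrArg Subtype.val ((ha.subsingleton_path a b).elim ⟨p, hp⟩ ⟨q, hq⟩)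

section Order

variable {V : Type u} {T : SimpleGraph V} {r : V}

theorem Below.refl (x : V) : Below T r x x := fun p => p.end_mem_support

theorem root_below (x : V) : Below T r r x := fun p => p.start_mem_support

theorem Below.trans {x y z : V} (h₁ : Below T r x y) (h₂ : Below T r y z) : Below T r x z := by
  classical
  intro p
  exact p.support_takeUntil_subset_support (h₂ p) (h₁ _)

theorem exists_isPath (hc : T.Preconnected) (x y : V) : ∃ p : T.Walk x y, p.IsPath := by
  classical
  obtain ⟨p⟩ := hc x y
  exact ⟨p.bypass, p.bypass_isPath⟩

theorem Below.antisymm (hc : T.Preconnected) {x y : V} (h₁ : Below T r x y) (h₂ : Below T r y x) :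
    x = y := by
  classical
  obtain ⟨p, hp⟩ := exists_isPath hc r y
  exact (eq_of_mem_takeUntil_of_mem_dropUntil hp (h₁ p) (h₂ _) (Walk.end_mem_support _)).symm

theorem mem_takeUntil_or_mem_takeUntil [DecidableEq V] {a b x y : V} (p : T.Walk a b)
    (hx : x ∈ p.support) (hy : y ∈ p.support) :
    x ∈ (p.takeUntil y hy).support ∨ y ∈ (p.takeUntil x hx).support := by
  induction p with
  | nil =>
    obtain rfl := List.mem_singleton.1 hx
    exact Or.inl (Walk.start_mem_support _)
  | cons h p ih =>
    rename_i u v w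
    by_cases hxu : x = u
    · subst hxu
      exact Or.inl (Walk.start_mem_support _)
    by_cases hyu : y = u
    · subst hyu
      exact Or.inr (Walk.start_mem_support _)
    have hx' : x ∈ p.support := by simpa [hxu] using hx
    have hy' : y ∈ p.support := by simpa [hyu] using hy
    rw [Walk.takeUntil_cons hy' (Ne.symm hyu), Walk.takeUntil_cons hx' (Ne.symm hxu)]
    simpa [hxu, hyu] using ih hx' hy'

/-- Both vertices lie on the path to `z`. If `x` comes first there, any walk to `y` continues along
the rest of that path, which avoids `x` unless `x = y`; so `x` is met on the way to `y`. -/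
theorem Below.total (hc : T.Preconnected) {x y z : V} (h₁ : Below T r x z) (h₂ : Below T r y z) :
    Below T r x y ∨ Below T r y x := by
  classical
  obtain ⟨p, hp⟩ := exists_isPath hc r z
  have key : ∀ {x y : V} (h₁ : Below T r x z) (h₂ : Below T r y z),
      x ∈ (p.takeUntil y (h₂ p)).support → Below T r x y := by
    intro x y h₁ h₂ h q
    have := h₁ (q.append (p.dropUntil y (h₂ p)))
    rw [Walk.mem_support_append_iff] at this
    refine this.elim id fun h' => ?_
    rw [eq_of_mem_takeUntil_of_mem_dropUntil hp (h₂ p) h h']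
    exact q.end_mem_support
  exact (mem_takeUntil_or_mem_takeUntil p (h₁ p) (h₂ p)).imp (key h₁ h₂) (key h₂ h₁)

theorem Below.dist_lt (hc : T.Preconnected) {x y : V} (h : Below T r x y) (hne : x ≠ y) :
    T.dist r x < T.dist r y := by
  classical
  obtain ⟨p, hp⟩ := (hc r y).exists_walk_length_eq_dist
  rw [← hp]
  exact (dist_le _).trans_lt (Walk.length_takeUntil_lt_length (h p) hne)

theorem Below.dist_le (hc : T.Preconnected) {x y : V} (h : Below T r x y) :
    T.dist r x ≤ T.dist r y := by
  rcases eq_or_ne x y with rfl | hne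
  · rfl
  · exact (h.dist_lt hc hne).le

theorem Below.of_adj {x y z : V} (hxy : T.Adj x y) (hz : Below T r z y) (hne : z ≠ y) :
    Below T r z x := by
  intro p
  have := hz (p.concat hxy)
  rw [Walk.support_concat] at this
  simpa [hne] using this

theorem Below.parent_unique (hc : T.Preconnected) {x x' y : V} (hxy : T.Adj x y)
    (h : Below T r x y) (hxy' : T.Adj x' y) (h' : Below T r x' y) : x = x' :=
  (Below.of_adj hxy' h hxy.ne).antisymm hc (Below.of_adj hxy h' hxy'.ne)

theorem below_of_mem_support (ha : T.IsAcyclic) {x y : V} {q : T.Walk r y} (hq : q.IsPath)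
    (hx : x ∈ q.support) : Below T r x y := by
  classical
  intro p
  have : p.bypass = q := eq_of_isPath ha p.bypass_isPath hq
  exact p.support_bypass_subset_support (this ▸ hx)

theorem below_or_below_of_adj (hc : T.Preconnected) (ha : T.IsAcyclic) {x y : V}
    (h : T.Adj x y) : Below T r x y ∨ Below T r y x := by
  classical
  obtain ⟨p, hp⟩ := exists_isPath hc r x
  by_cases hy : y ∈ p.support
  · exact Or.inr (below_of_mem_support ha hp hy)
  · refine Or.inl (below_of_mem_support ha (hp.concat hy h) ?_)
    simp [Walk.support_concat]

theorem exists_parent (hc : T.Preconnected) (ha : T.IsAcyclic) {y : V} (hy : y ≠ r) :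
    ∃ x, T.Adj x y ∧ Below T r x y := by
  obtain ⟨p, hp⟩ := exists_isPath hc r y
  have hn : ¬ p.Nil := fun h => hy h.eq.symm
  exact ⟨p.penultimate, p.adj_penultimate hn,
    below_of_mem_support ha hp (p.getVert_mem_support _)⟩

theorem exists_child (hc : T.Preconnected) (ha : T.IsAcyclic) {x z : V} (h : Below T r x z)
    (hne : x ≠ z) : ∃ c, T.Adj x c ∧ Below T r x c ∧ Below T r c z := by
  induction hn : T.dist r z using Nat.strong_induction_on generalizing z with
  | _ n ih =>
    subst hn
    have hz : z ≠ r := by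
      rintro rfl
      exact hne (h.antisymm hc (root_below x))
    obtain ⟨w, hw, hwz⟩ := exists_parent hc ha hz
    rcases eq_or_ne x w with rfl | hxw
    · exact ⟨z, hw, hwz, .refl z⟩
    · obtain ⟨c, h₁, h₂, h₃⟩ := ih _ (hwz.dist_lt hc hw.ne) (Below.of_adj hw h hne) hxw rfl
      exact ⟨c, h₁, h₂, h₃.trans hwz⟩

/-- Distinct children of a vertex have no common upper bound. -/
theorem child_unique (hc : T.Preconnected) {x c c' z : V} (h : T.Adj x c)
    (hx : Below T r x c) (h' : T.Adj x c') (hx' : Below T r x c') (hz : Below T r c z)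
    (hz' : Below T r c' z) : c = c' := by
  by_contra hne
  rcases hz.total hc hz' with h₁ | h₁
  · exact h.ne (hx.antisymm hc (Below.of_adj h' h₁ hne))
  · exact h'.ne (hx'.antisymm hc (Below.of_adj h h₁ (Ne.symm hne)))

/-- A set can only be entered through the ends of the edges that lead into it. -/
theorem mem_support_of_boundary {A : Set V} {ρ : V}
    (hA : ∀ a ∈ A, ∀ b ∉ A, T.Adj a b → a = ρ) {x y : V} (hx : x ∈ A) (hy : y ∉ A)
    (p : T.Walk x y) : ρ ∈ p.support := by
  obtain ⟨d, hd, h₁, h₂⟩ := p.exists_boundary_dart A hx hy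
  rw [← hA _ h₁ _ h₂ d.adj]
  exact p.dart_fst_mem_support_of_mem_darts hd

theorem below_of_boundary {A : Set V} {ρ : V} (hA : ∀ a ∈ A, ∀ b ∉ A, T.Adj a b → a = ρ)
    (hr : r ∈ A → r = ρ) {z : V} (hz : z ∈ A) : Below T r ρ z := by
  intro p
  by_cases h : r ∈ A
  · rw [← hr h]
    exact p.start_mem_support
  · have := mem_support_of_boundary hA hz h p.reverse
    simpa using this

/-- Otherwise the path from `r` to `z` would meet `ρ` both before `y`, on entering `A`, and after
`y`, on leaving it. -/
theorem mem_of_below_of_boundary (hc : T.Preconnected) {A : Set V} {ρ : V}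
    (hA : ∀ a ∈ A, ∀ b ∉ A, T.Adj a b → a = ρ)
    (hr : r ∈ A → r = ρ) {y z : V} (hy : y ∈ A) (hne : y ≠ ρ) (hyz : Below T r y z) : z ∈ A := by
  classical
  by_contra hz
  obtain ⟨p, hp⟩ := exists_isPath hc r z
  exact hne (eq_of_mem_takeUntil_of_mem_dropUntil hp (hyz p) (below_of_boundary hA hr hy _)
    (mem_support_of_boundary hA hy hz _)).symm

theorem mem_support_of_below (hc : T.Preconnected) (ha : T.IsAcyclic) {x w z : V}
    (hxw : Below T r x w) (hwz : Below T r w z) (p : T.Walk x z) : w ∈ p.support := by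
  obtain ⟨q, hq⟩ := exists_isPath hc r x
  have := hwz (q.append p)
  rw [Walk.mem_support_append_iff] at this
  rcases this with h | h
  · rw [← hxw.antisymm hc (below_of_mem_support ha hq h)]
    exact p.start_mem_support
  · exact h

theorem mem_support_iff_below (hc : T.Preconnected) (ha : T.IsAcyclic) {x w z : V}
    (hxz : Below T r x z) {p : T.Walk x z} (hp : p.IsPath) :
    w ∈ p.support ↔ Below T r x w ∧ Below T r w z := by
  classical
  refine ⟨fun h => ?_, fun h => mem_support_of_below hc ha h.1 h.2 p⟩
  obtain ⟨q, hq⟩ := exists_isPath hc r z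
  have e : p = q.dropUntil x (hxz q) := eq_of_isPath ha hp (hq.dropUntil _)
  subst e
  have hwz := below_of_mem_support ha hq (q.support_dropUntil_subset_support _ h)
  refine ⟨(hxz.total hc hwz).elim id fun h' => ?_, hwz⟩
  rw [eq_of_mem_takeUntil_of_mem_dropUntil hq (hxz q) (h' _) h]
  exact .refl x

/-- A walk that leaves the part of the tree above `x` passes through the parent of `x`. -/
theorem parent_mem_support (hc : T.Preconnected) (ha : T.IsAcyclic) {w x y : V} (hwx : T.Adj w x)
    (hw : Below T r w x) (hxy : ¬ Below T r x y) (p : T.Walk x y) : w ∈ p.support := by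
  obtain ⟨d, hd, h₁, h₂⟩ := p.exists_boundary_dart {z | Below T r x z} (.refl x) hxy
  simp only [Set.mem_ofPred_eq] at h₁ h₂
  have hb : Below T r d.snd d.fst := (below_or_below_of_adj hc ha d.adj).resolve_left
    fun h => h₂ (h₁.trans h)
  have hx : x = d.fst := by
    by_contra hne
    exact h₂ (Below.of_adj d.adj.symm h₁ hne)
  have : w = d.snd := Below.parent_unique hc (hx ▸ hwx) (hx ▸ hw) d.adj.symm hb
  rw [this]
  exact p.dart_snd_mem_support_of_mem_darts hd

theorem mem_edges_of_adj (ha : T.IsAcyclic) {a b x y : V} {p : T.Walk a b} (hp : p.IsPath)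
    (h : T.Adj x y) (hx : x ∈ p.support) (hy : y ∈ p.support) : s(x, y) ∈ p.edges := by
  classical
  have key : ∀ {x y : V} (_ : T.Adj x y) (hy : y ∈ p.support),
      x ∈ (p.takeUntil y hy).support → s(x, y) ∈ p.edges := by
    intro x y h hy hx
    have e : ((p.takeUntil y hy).dropUntil x hx) = h.toWalk :=
      eq_of_isPath ha ((hp.takeUntil _).dropUntil _) (Walk.IsPath.of_adj h)
    apply p.edges_takeUntil_subset_edges hy
    apply (p.takeUntil y hy).edges_dropUntil_subset_edges hx
    rw [e]
    simp
  rcases mem_takeUntil_or_mem_takeUntil p hx hy with h' | h'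
  · exact key h hy h'
  · rw [Sym2.eq_swap]
    exact key h.symm hx h'

end Order

/-! ## Branching sets and subdivisions of the binary tree -/

/-- There is a nonempty set of vertices each of which lies below two incomparable members of the
set. -/
def Branching {V : Type u} (T : SimpleGraph V) (r : V) : Prop :=
  ∃ B : Set V, B.Nonempty ∧ ∀ b ∈ B, ∃ c ∈ B, ∃ d ∈ B,
    Below T r b c ∧ Below T r b d ∧ ¬ Below T r c d ∧ ¬ Below T r d c

theorem binaryTree_adj_append (s : List Bool) (b : Bool) : binaryTree.Adj s (s ++ [b]) := by
  simp [binaryTree]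

theorem exists_append_of_binaryTree_adj {s t : List Bool} (h : binaryTree.Adj s t) :
    (∃ b, t = s ++ [b]) ∨ ∃ b, s = t ++ [b] := by
  simpa [binaryTree] using (fromRel_adj _ _ _).1 h |>.2

section Subdivision

variable {V : Type u} {T : SimpleGraph V} {r : V} {U : Type v} {W : Type w} {G : SimpleGraph U}
  {H : SimpleGraph W}

/-- A path that does not end above its origin passes through the parent of that origin. Two such
paths would share the parent, which would then have to be the far end of both. -/
theorem Subdivision.below_or_below (hc : T.Preconnected) (ha : T.IsAcyclic) (S : Subdivision G H)
    (f : H ↪g T) {s t t' : U} (h : G.Adj s t) (h' : G.Adj s t') (hne : t ≠ t') :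
    Below T r (f (S.branch s)) (f (S.branch t)) ∨ Below T r (f (S.branch s)) (f (S.branch t')) := by
  by_contra! hn
  have hr : f (S.branch s) ≠ r := fun e => hn.1 (e ▸ root_below _)
  obtain ⟨w, hw, hw'⟩ := exists_parent hc ha hr
  have h₁ := parent_mem_support hc ha hw hw' hn.1 ((S.path s t h).map f.toHom)
  have h₂ := parent_mem_support hc ha hw hw' hn.2 ((S.path s t' h').map f.toHom)
  rw [Walk.support_map, List.mem_map] at h₁ h₂
  obtain ⟨x, hx, rfl⟩ := h₁
  obtain ⟨x', hx', e⟩ := h₂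
  obtain rfl := f.injective e
  have hs : s(s, t) ≠ s(s, t') := fun e => hne (Sym2.congr_right.1 e)
  have hxs : x' ≠ S.branch s := by
    rintro rfl
    exact hw.ne rfl
  have e₁ := (S.disjoint _ _ h _ _ h' _ hs hx hx').resolve_left hxs
  have e₂ := (S.disjoint _ _ h' _ _ h _ hs.symm hx' hx).resolve_left hxs
  exact hne (S.branch_injective (e₁.symm.trans e₂))

theorem Subdivision.branching (hc : T.Preconnected) (ha : T.IsAcyclic)
    (S : Subdivision binaryTree H) (f : H ↪g T) : Branching T r := by
  have hinj : Function.Injective fun s => f (S.branch s) := f.injective.comp S.branch_injective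
  -- One path at the image of the empty sequence may lead down towards `r`; only sequences that
  -- start with a `b` leading up are used.
  obtain ⟨b, hb⟩ : ∃ b, Below T r (f (S.branch [])) (f (S.branch [b])) := by
    rcases S.below_or_below (r := r) hc ha f (binaryTree_adj_append [] true)
      (binaryTree_adj_append [] false) (by simp) with h | h
    exacts [⟨_, h⟩, ⟨_, h⟩]
  -- At the image of `s ++ [d]` the path back to `s` already leads down, so the other two must lead
  -- up.
  have up : ∀ s d c, Below T r (f (S.branch s)) (f (S.branch (s ++ [d]))) →
      Below T r (f (S.branch (s ++ [d]))) (f (S.branch (s ++ [d] ++ [c]))) := by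
    intro s d c h
    refine (S.below_or_below hc ha f (binaryTree_adj_append s d).symm
      (binaryTree_adj_append (s ++ [d]) c) (by simp)).resolve_left fun h' => ?_
    exact (binaryTree_adj_append s d).ne (hinj (h.antisymm hc h'))
  have key : ∀ s c, Below T r (f (S.branch (b :: s))) (f (S.branch (b :: s ++ [c]))) := by
    intro s
    induction s using List.reverseRecOn with
    | nil => exact fun c => up [] b c hb
    | append_singleton s d ih => exact fun c => up (b :: s) d c (ih d)
  -- If one successor were below the other, it would lie on the path that leads to the other,
  -- against `branch_mem`.
  have inc : ∀ s c d, c ≠ d →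
      ¬ Below T r (f (S.branch (b :: s ++ [c]))) (f (S.branch (b :: s ++ [d]))) := by
    intro s c d hcd h
    have := mem_support_of_below hc ha (key s c) h
      ((S.path _ _ (binaryTree_adj_append (b :: s) d)).map f.toHom)
    rw [Walk.support_map, List.mem_map] at this
    obtain ⟨x, hx, e⟩ := this
    obtain rfl := f.injective e
    have := S.branch_mem _ _ _ _ hx
    simp [hcd] at this
  refine ⟨Set.range fun s => f (S.branch (b :: s)), Set.range_nonempty _, ?_⟩
  rintro _ ⟨s, rfl⟩
  exact ⟨_, ⟨s ++ [true], rfl⟩, _, ⟨s ++ [false], rfl⟩, key s _, key s _, inc s _ _ (by simp),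
    inc s _ _ (by simp)⟩

end Subdivision

theorem isScattered_of_not_branching {V : Type u} {T : SimpleGraph V} {r : V}
    (hc : T.Preconnected) (ha : T.IsAcyclic) (h : ¬ Branching T r) : IsScattered T :=
  fun _ _ ⟨S⟩ => ⟨fun f => h (S.branching hc ha f)⟩

/-! ### Maps of the binary tree into a tree, and their hulls -/

section Meets

variable {V : Type u} {T : SimpleGraph V} {r : V}

/-- Climb from `b` as long as `x` and `y` lie above the same child; each move brings the vertex
nearer to `x`. -/
theorem exists_meet (hc : T.Preconnected) (ha : T.IsAcyclic) {b x y : V} (hx : Below T r b x)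
    (hy : Below T r b y) (hxy : ¬ Below T r x y) (hyx : ¬ Below T r y x) :
    ∃ m c d, Below T r b m ∧ T.Adj m c ∧ T.Adj m d ∧ Below T r m c ∧ Below T r m d ∧ c ≠ d ∧
      Below T r c x ∧ Below T r d y := by
  induction hn : T.dist r x - T.dist r b using Nat.strong_induction_on generalizing b with
  | _ n ih =>
    have hbx : b ≠ x := by
      rintro rfl
      exact hxy hy
    have hby : b ≠ y := by
      rintro rfl
      exact hyx hx
    obtain ⟨c, h₁, h₂, h₃⟩ := exists_child hc ha hx hbx
    obtain ⟨d, h₁', h₂', h₃'⟩ := exists_child hc ha hy hby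
    rcases eq_or_ne c d with rfl | hne
    · have := h₂.dist_lt hc h₁.ne
      have := h₃.dist_le hc
      obtain ⟨m, c', d', hm⟩ := ih _ (by omega) h₃ h₃' rfl
      exact ⟨m, c', d', h₂.trans hm.1, hm.2⟩
    · exact ⟨b, c, d, .refl b, h₁, h₁', h₂, h₂', hne, h₃, h₃'⟩

/-- A map of the binary tree into a tree that respects the order and sends distinct successors
above distinct children. -/
structure BinaryMap (T : SimpleGraph V) (r : V) where
  vertex : List Bool → V
  child : List Bool → Bool → V
  adj : ∀ s b, T.Adj (vertex s) (child s b)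
  below_child : ∀ s b, Below T r (vertex s) (child s b)
  child_ne : ∀ s, child s true ≠ child s false
  child_below : ∀ s b, Below T r (child s b) (vertex (s ++ [b]))

theorem Branching.exists_binaryMap (hc : T.Preconnected) (ha : T.IsAcyclic)
    (h : Branching T r) : Nonempty (BinaryMap T r) := by
  obtain ⟨B, ⟨b₀, hb₀⟩, hB⟩ := h
  have H : ∀ b : B, ∃ (m : V) (c : Bool → V) (x : Bool → B), Below T r b m ∧
      (∀ i, T.Adj m (c i)) ∧ (∀ i, Below T r m (c i)) ∧ c true ≠ c false ∧
      ∀ i, Below T r (c i) (x i) := by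
    rintro ⟨b, hb⟩
    obtain ⟨x, hx, y, hy, h₁, h₂, h₃, h₄⟩ := hB b hb
    obtain ⟨m, c, d, hm, hmc, hmd, hmc', hmd', hne, hcx, hdy⟩ := exists_meet hc ha h₁ h₂ h₃ h₄
    refine ⟨m, fun i => bif i then c else d, fun i => bif i then ⟨x, hx⟩ else ⟨y, hy⟩, hm,
      ?_, ?_, hne, ?_⟩ <;> rintro (_ | _) <;> assumption
  choose m c x h₁ h₂ h₃ h₄ h₅ using H
  -- `g s` is a member of `B` reached by following `s`; the vertex assigned to `s` is the point
  -- above `g s` where two further members part.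
  let g : List Bool → B := fun s => s.foldl (fun b i => x b i) ⟨b₀, hb₀⟩
  refine ⟨⟨fun s => m (g s), fun s i => c (g s) i, fun s => h₂ _, fun s => h₃ _, fun s => h₄ _,
    fun s i => ?_⟩⟩
  have : g (s ++ [i]) = x (g s) i := by simp [g, List.foldl_append]
  rw [this]
  exact (h₅ _ _).trans (h₁ _)

namespace BinaryMap

variable (g : BinaryMap T r)

theorem below_append (s t : List Bool) : Below T r (g.vertex s) (g.vertex (s ++ t)) := by
  induction t using List.reverseRecOn with
  | nil => simpa using Below.refl _
  | append_singleton t b ih =>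
    rw [← List.append_assoc]
    exact ih.trans ((g.below_child _ b).trans (g.child_below _ b))

theorem child_below_append (s : List Bool) (b : Bool) (t : List Bool) :
    Below T r (g.child s b) (g.vertex (s ++ b :: t)) := by
  have := (g.child_below s b).trans (g.below_append (s ++ [b]) t)
  simpa using this

theorem child_injective (s : List Bool) : Function.Injective (g.child s) := by
  rintro (_ | _) (_ | _) h
  · rfl
  · exact absurd h.symm (g.child_ne s)
  · exact absurd h (g.child_ne s)
  · rfl

/-- Two sequences are comparable or part at some place. -/
theorem prefix_or_prefix_or_fork (s t : List Bool) :
    s <+: t ∨ t <+: s ∨ ∃ u b c s' t', b ≠ c ∧ s = u ++ b :: s' ∧ t = u ++ c :: t' := by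
  induction s generalizing t with
  | nil => exact Or.inl List.nil_prefix
  | cons a s ih =>
    cases t with
    | nil => exact Or.inr (Or.inl List.nil_prefix)
    | cons b t =>
      by_cases hab : a = b
      · subst hab
        rcases ih t with h | h | ⟨u, b, c, s', t', hne, rfl, rfl⟩
        · exact Or.inl (by simpa using h)
        · exact Or.inr (Or.inl (by simpa using h))
        · exact Or.inr (Or.inr ⟨a :: u, b, c, s', t', hne, rfl, rfl⟩)
      · exact Or.inr (Or.inr ⟨[], a, b, s, t, hab, rfl, rfl⟩)

/-- A common lower bound of the images of two sequences that part at `u` is below the image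
of `u`. -/
theorem below_of_fork (hc : T.Preconnected) (ha : T.IsAcyclic) {u s t : List Bool} {b c : Bool}
    (hbc : b ≠ c) {x : V} (hs : Below T r x (g.vertex (u ++ b :: s)))
    (ht : Below T r x (g.vertex (u ++ c :: t))) : Below T r x (g.vertex u) := by
  by_contra hx
  have h : Below T r (g.vertex u) x := (hs.total hc (g.below_append u _)).resolve_left hx
  have hne : g.vertex u ≠ x := by
    rintro rfl
    exact hx (.refl _)
  obtain ⟨d, h₁, h₂, h₃⟩ := exists_child hc ha h hne
  have e₁ := child_unique hc h₁ h₂ (g.adj u b) (g.below_child u b) (h₃.trans hs)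
    (g.child_below_append u b s)
  have e₂ := child_unique hc h₁ h₂ (g.adj u c) (g.below_child u c) (h₃.trans ht)
    (g.child_below_append u c t)
  exact hbc (g.child_injective u (e₁.symm.trans e₂))

theorem ne_vertex_append (hc : T.Preconnected) (s : List Bool) (b : Bool) (t : List Bool) :
    g.vertex s ≠ g.vertex (s ++ b :: t) := by
  intro e
  exact (g.adj s b).ne ((g.below_child s b).antisymm hc (e ▸ g.child_below_append s b t))

theorem below_iff (hc : T.Preconnected) (ha : T.IsAcyclic) {s t : List Bool} :
    Below T r (g.vertex s) (g.vertex t) ↔ s <+: t := by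
  constructor
  · intro h
    rcases prefix_or_prefix_or_fork s t with h' | ⟨u, rfl⟩ | ⟨u, b, c, s', t', hne, rfl, rfl⟩
    · exact h'
    · cases u with
      | nil => simp
      | cons b u =>
        exact absurd ((g.below_append t _).antisymm hc h) (g.ne_vertex_append hc t b u)
    · exact absurd ((g.below_append u _).antisymm hc (g.below_of_fork hc ha hne (.refl _) h))
        (g.ne_vertex_append hc u b s')
  · rintro ⟨u, rfl⟩
    exact g.below_append s u

theorem vertex_injective (hc : T.Preconnected) (ha : T.IsAcyclic) :
    Function.Injective g.vertex := by
  intro s t h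
  have h₁ : s <+: t := (g.below_iff hc ha).1 (h ▸ .refl _)
  have h₂ : t <+: s := (g.below_iff hc ha).1 (h ▸ .refl _)
  exact h₁.eq_of_length (le_antisymm h₁.length_le h₂.length_le)

/-- The vertices between the image of the empty sequence and the images of other sequences. -/
def hull : Set V := {x | Below T r (g.vertex []) x ∧ ∃ s, Below T r x (g.vertex s)}

theorem exists_segment (hc : T.Preconnected) {x : V}
    (hx : x ∈ g.hull) (hne : x ≠ g.vertex []) : ∃ s b, Below T r (g.vertex s) x ∧
      Below T r x (g.vertex (s ++ [b])) ∧ x ≠ g.vertex s := by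
  obtain ⟨h, s, hs⟩ := hx
  induction s using List.reverseRecOn with
  | nil => exact absurd (hs.antisymm hc h) hne
  | append_singleton s b ih =>
    by_cases h' : Below T r x (g.vertex s)
    · exact ih h'
    · refine ⟨s, b, (hs.total hc (g.below_append s _)).resolve_left h', hs, ?_⟩
      rintro rfl
      exact h' (.refl _)

/-- If the two upper ends are comparable, one segment starts where or after the other ends. If they
part at `u`, then `x` is below the image of `u`, hence below the start of its own segment. -/
theorem eq_of_mem_segments (hc : T.Preconnected) (ha : T.IsAcyclic) {s t : List Bool} {b c : Bool}
    (hne : s ++ [b] ≠ t ++ [c]) {x : V} (h₁ : Below T r (g.vertex s) x)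
    (h₂ : Below T r x (g.vertex (s ++ [b]))) (h₃ : Below T r (g.vertex t) x)
    (h₄ : Below T r x (g.vertex (t ++ [c]))) : x = g.vertex s ∨ x = g.vertex (s ++ [b]) := by
  rcases prefix_or_prefix_or_fork (s ++ [b]) (t ++ [c]) with h | h | ⟨u, d, e, s', t', hde, h, h'⟩
  · have : s ++ [b] <+: t := (List.prefix_concat_iff.1 h).resolve_left hne
    exact Or.inr (h₂.antisymm hc (((g.below_iff hc ha).2 this).trans h₃))
  · have : t ++ [c] <+: s := (List.prefix_concat_iff.1 h).resolve_left hne.symm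
    exact Or.inl ((h₄.trans ((g.below_iff hc ha).2 this)).antisymm hc h₁)
  · have hx : Below T r x (g.vertex u) := g.below_of_fork hc ha hde (h ▸ h₂) (h' ▸ h₄)
    have hu : u <+: s := by
      refine (List.prefix_concat_iff.1 (show u <+: s ++ [b] from ⟨_, h.symm⟩)).resolve_left ?_
      intro hus
      have := congrArg List.length (hus.trans h)
      simp at this
    exact Or.inl ((hx.trans ((g.below_iff hc ha).2 hu)).antisymm hc h₁)

end BinaryMap

end Meets

namespace BinaryMap

variable {V : Type u} {T : SimpleGraph V} {r : V} (g : BinaryMap T r)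

/-- The image of a sequence in the hull. -/
def hullVertex (s : List Bool) : g.hull :=
  ⟨g.vertex s, by simpa using g.below_append [] s, s, .refl _⟩

theorem hull_preconnected (hc : T.Preconnected) (ha : T.IsAcyclic) :
    (T.induce g.hull).Preconnected := by
  have key : ∀ x : g.hull, (T.induce g.hull).Reachable (g.hullVertex []) x := by
    rintro ⟨x, hx⟩
    obtain ⟨p, hp⟩ := exists_isPath hc (g.vertex []) x
    refine ⟨p.induce g.hull fun y hy => ?_⟩
    have := (mem_support_iff_below hc ha hx.1 hp).1 hy
    obtain ⟨-, s, hs⟩ := hx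
    exact ⟨this.1, s, this.2.trans hs⟩
  exact fun x y => (key x).symm.trans (key y)

theorem mem_support_hull_iff (hc : T.Preconnected) (ha : T.IsAcyclic) {s : List Bool} {b : Bool}
    {p : (T.induce g.hull).Walk (g.hullVertex s) (g.hullVertex (s ++ [b]))} (hp : p.IsPath)
    (x : g.hull) :
    x ∈ p.support ↔ Below T r (g.vertex s) x ∧ Below T r x (g.vertex (s ++ [b])) := by
  have hinj := (Embedding.induce (G := T) g.hull).injective
  have h : x ∈ p.support ↔ (x : V) ∈ (p.map (Embedding.induce (G := T) g.hull).toHom).support := by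
    rw [Walk.support_map]
    exact (List.mem_map_of_injective hinj).symm
  exact h.trans (mem_support_iff_below hc ha (g.below_append s [b]) (hp.map hinj))

/-- The edges of the binary tree carry no orientation; this describes every path by its lower and
upper end, whichever way it is traversed. -/
theorem exists_mem_support_hull_iff (hc : T.Preconnected) (ha : T.IsAcyclic) {u v : List Bool}
    (h : binaryTree.Adj u v) : ∃ s b, s(u, v) = s(s, s ++ [b]) ∧
      ∀ p : (T.induce g.hull).Walk (g.hullVertex u) (g.hullVertex v), p.IsPath → ∀ x : g.hull,
        x ∈ p.support ↔ Below T r (g.vertex s) x ∧ Below T r x (g.vertex (s ++ [b])) := by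
  rcases exists_append_of_binaryTree_adj h with ⟨b, rfl⟩ | ⟨b, rfl⟩
  · exact ⟨u, b, rfl, fun p hp x => g.mem_support_hull_iff hc ha hp x⟩
  · refine ⟨v, b, Sym2.eq_swap, fun p hp x => ?_⟩
    rw [← g.mem_support_hull_iff hc ha hp.reverse x, Walk.support_reverse, List.mem_reverse]

/-- The hull of a map of the binary tree is a subdivision of the binary tree. -/
noncomputable def subdivision (hc : T.Preconnected) (ha : T.IsAcyclic) :
    Subdivision binaryTree (T.induce g.hull) where
  branch := g.hullVertex
  branch_injective := fun _ _ h => g.vertex_injective hc ha (congrArg Subtype.val h)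
  path u v _ := (exists_isPath (g.hull_preconnected hc ha) _ _).choose
  path_isPath u v _ := (exists_isPath (g.hull_preconnected hc ha) _ _).choose_spec
  path_symm u v _ := eq_of_isPath (ha.induce _)
    (exists_isPath (g.hull_preconnected hc ha) _ _).choose_spec
    (exists_isPath (g.hull_preconnected hc ha) _ _).choose_spec.reverse
  branch_mem u v h x hx := by
    obtain ⟨s, b, e, hs⟩ := g.exists_mem_support_hull_iff hc ha h
    rw [hs _ (exists_isPath (g.hull_preconnected hc ha) _ _).choose_spec] at hx
    have h₁ : s <+: x := (g.below_iff hc ha).1 hx.1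
    have h₂ : x <+: s ++ [b] := (g.below_iff hc ha).1 hx.2
    have h₃ : x ∈ s(s, s ++ [b]) := by
      rw [Sym2.mem_iff]
      rcases List.prefix_concat_iff.1 h₂ with h₂ | h₂
      · exact Or.inr h₂
      · exact Or.inl (h₂.eq_of_length (le_antisymm h₂.length_le h₁.length_le))
    rw [← e] at h₃
    exact Sym2.mem_iff.1 h₃
  disjoint u v h u' v' h' x hne hx hx' := by
    obtain ⟨s, b, e, hs⟩ := g.exists_mem_support_hull_iff hc ha h
    obtain ⟨t, c, e', ht⟩ := g.exists_mem_support_hull_iff hc ha h'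
    rw [hs _ (exists_isPath (g.hull_preconnected hc ha) _ _).choose_spec] at hx
    rw [ht _ (exists_isPath (g.hull_preconnected hc ha) _ _).choose_spec] at hx'
    have hst : s ++ [b] ≠ t ++ [c] := by
      intro h
      obtain ⟨rfl, hbc⟩ := List.append_inj' h rfl
      exact hne (by rw [e, e', h])
    have h₁ : ∃ y ∈ s(s, s ++ [b]), x = g.hullVertex y := by
      rcases g.eq_of_mem_segments hc ha hst hx.1 hx.2 hx'.1 hx'.2 with h | h
      · exact ⟨s, Sym2.mem_mk_left _ _, Subtype.ext h⟩
      · exact ⟨_, Sym2.mem_mk_right _ _, Subtype.ext h⟩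
    rw [← e] at h₁
    obtain ⟨y, hy, rfl⟩ := h₁
    rcases Sym2.mem_iff.1 hy with rfl | rfl
    exacts [Or.inl rfl, Or.inr rfl]
  vertex_cover x := by
    by_cases hx : (x : V) = g.vertex []
    · exact Or.inl ⟨[], Subtype.ext hx⟩
    · obtain ⟨s, b, h₁, h₂, -⟩ := g.exists_segment hc x.2 hx
      refine Or.inr ⟨s, s ++ [b], binaryTree_adj_append s b, ?_⟩
      rw [g.mem_support_hull_iff hc ha
        (exists_isPath (g.hull_preconnected hc ha) _ _).choose_spec]
      exact ⟨h₁, h₂⟩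
  edge_cover := by
    have key : ∀ x y : g.hull, (T.induce g.hull).Adj x y → Below T r (x : V) y →
        ∃ u v, ∃ _ : binaryTree.Adj u v, s(x, y) ∈
          (exists_isPath (g.hull_preconnected hc ha) (g.hullVertex u)
            (g.hullVertex v)).choose.edges := by
      intro x y h hxy
      have h' : T.Adj x y := h
      have hy : (y : V) ≠ g.vertex [] := by
        intro e
        exact h'.ne (hxy.antisymm hc (e ▸ x.2.1))
      obtain ⟨s, b, h₁, h₂, h₃⟩ := g.exists_segment hc y.2 hy
      refine ⟨s, s ++ [b], binaryTree_adj_append s b, ?_⟩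
      have hp := (exists_isPath (g.hull_preconnected hc ha) (g.hullVertex s)
        (g.hullVertex (s ++ [b]))).choose_spec
      refine mem_edges_of_adj (ha.induce _) hp h ?_ ?_
      · rw [g.mem_support_hull_iff hc ha hp]
        exact ⟨Below.of_adj h' h₁ h₃.symm, hxy.trans h₂⟩
      · rw [g.mem_support_hull_iff hc ha hp]
        exact ⟨h₁, h₂⟩
    intro x y h
    rcases below_or_below_of_adj (r := r) hc ha (show T.Adj x y from h) with h' | h'
    · exact key x y h h'
    · rw [Sym2.eq_swap]
      exact key y x h.symm h'

end BinaryMap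

theorem isScattered_iff_not_branching {V : Type u} {T : SimpleGraph V} (r : V)
    (hc : T.Preconnected) (ha : T.IsAcyclic) : IsScattered T ↔ ¬ Branching T r := by
  refine ⟨fun h hB => ?_, isScattered_of_not_branching hc ha⟩
  obtain ⟨g⟩ := hB.exists_binaryMap hc ha
  exact (h _ _ ⟨g.subdivision hc ha⟩).false (Embedding.induce g.hull)

/-! ## Rays and ends -/

namespace Ray

variable {V : Type u} {T : SimpleGraph V} {r : V}

theorem toEnd_eq_iff {C D : Ray T} :
    C.toEnd = D.toEnd ↔ ∃ F : Set V, F.Finite ∧ C.verts \ F = D.verts \ F :=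
  Quotient.eq

theorem vertex_mem_verts (C : Ray T) (n : ℕ) : C.vertex n ∈ C.verts := ⟨n, rfl⟩

/-- The part of a ray from its `k`-th vertex on. -/
def tail (C : Ray T) (k : ℕ) : Ray T where
  vertex n := C.vertex (n + k)
  injective := C.injective.comp (add_left_injective k)
  adj n := by
    have := C.adj (n + k)
    rwa [show n + k + 1 = n + 1 + k by omega] at this

theorem tail_verts_subset (C : Ray T) (k : ℕ) : (C.tail k).verts ⊆ C.verts := by
  rintro _ ⟨n, rfl⟩
  exact ⟨n + k, rfl⟩

theorem verts_subset_tail_verts_union (C : Ray T) (k : ℕ) :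
    C.verts ⊆ (C.tail k).verts ∪ C.vertex '' Set.Iio k := by
  rintro _ ⟨n, rfl⟩
  by_cases h : n < k
  · exact Or.inr ⟨n, h, rfl⟩
  · exact Or.inl ⟨n - k, congrArg C.vertex (by omega)⟩

theorem exists_cons (C : Ray T) {x : V} (h : T.Adj x (C.vertex 0)) (hx : x ∉ C.verts) :
    ∃ D : Ray T, D.vertex 0 = x ∧ D.verts = insert x C.verts := by
  refine ⟨⟨fun n => Nat.casesOn n x C.vertex, ?_, ?_⟩, rfl, ?_⟩
  · rintro (_ | m) (_ | n) e
    · rfl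
    · exact absurd ⟨n, e.symm⟩ hx
    · exact absurd ⟨m, e⟩ hx
    · exact congrArg _ (C.injective e)
  · rintro (_ | n)
    · exact h
    · exact C.adj n
  · ext y
    constructor
    · rintro ⟨_ | n, rfl⟩
      exacts [Or.inl rfl, Or.inr ⟨n, rfl⟩]
    · rintro (rfl | ⟨n, rfl⟩)
      exacts [⟨0, rfl⟩, ⟨n + 1, rfl⟩]

theorem exists_append (C : Ray T) {x y : V} {p : T.Walk x y} (hp : p.IsPath)
    (hy : C.vertex 0 = y) (h : ∀ z ∈ p.support, z ∈ C.verts → z = y) :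
    ∃ D : Ray T, D.vertex 0 = x ∧ D.verts = {z | z ∈ p.support} ∪ C.verts := by
  induction p with
  | nil =>
    refine ⟨C, hy, ?_⟩
    rw [eq_comm, Set.union_eq_right]
    intro z hz
    obtain rfl := List.mem_singleton.1 hz
    exact ⟨0, hy⟩
  | cons hxw p ih =>
    rename_i x w y
    rw [Walk.cons_isPath_iff] at hp
    obtain ⟨D, hD, hD'⟩ := ih hp.1 hy fun z hz => h z (by simp [hz])
    have hx : x ∉ D.verts := by
      rw [hD']
      rintro (hx | hx)
      · exact hp.2 hx
      · have := h x (by simp) hx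
        subst this
        exact hp.2 p.end_mem_support
    obtain ⟨E, hE, hE'⟩ := D.exists_cons (hD ▸ hxw) hx
    refine ⟨E, hE, ?_⟩
    rw [hE', hD']
    ext z
    simp [or_assoc]

theorem exists_path (C : Ray T) (n : ℕ) : ∃ p : T.Walk (C.vertex 0) (C.vertex n), p.IsPath ∧
    ∀ z, z ∈ p.support ↔ ∃ k ≤ n, z = C.vertex k := by
  induction n with
  | zero => exact ⟨.nil, .nil, fun z => by simp⟩
  | succ n ih =>
    obtain ⟨p, hp, h⟩ := ih
    refine ⟨p.concat (C.adj n), hp.concat (fun h' => ?_) _, fun z => ?_⟩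
    · obtain ⟨k, hk, e⟩ := (h _).1 h'
      have := C.injective e
      omega
    · rw [Walk.support_concat, List.mem_append, h, List.mem_singleton]
      constructor
      · rintro (⟨k, hk, rfl⟩ | rfl)
        exacts [⟨k, by omega, rfl⟩, ⟨n + 1, le_rfl, rfl⟩]
      · rintro ⟨k, hk, rfl⟩
        rcases Nat.le_succ_iff.1 hk with hk | rfl
        exacts [Or.inl ⟨k, hk, rfl⟩, Or.inr rfl]

theorem mem_verts_of_below {C : Ray T} (hC : C.vertex 0 = r) {s : V} {n : ℕ}
    (h : Below T r s (C.vertex n)) : s ∈ C.verts := by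
  subst hC
  obtain ⟨p, -, hp⟩ := C.exists_path n
  obtain ⟨k, -, rfl⟩ := (hp s).1 (h p)
  exact ⟨k, rfl⟩

/-- A ray from the root cannot turn downwards: the parent of a vertex is unique and is the preceding
vertex of the ray. -/
theorem below_succ (hc : T.Preconnected) (ha : T.IsAcyclic) {C : Ray T} (hC : C.vertex 0 = r)
    (n : ℕ) : Below T r (C.vertex n) (C.vertex (n + 1)) := by
  induction n with
  | zero => exact hC ▸ root_below _
  | succ n ih =>
    refine (below_or_below_of_adj hc ha (C.adj (n + 1))).resolve_right fun h => ?_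
    have := C.injective (Below.parent_unique hc (C.adj n) ih (C.adj (n + 1)).symm h)
    omega

theorem below_of_le (hc : T.Preconnected) (ha : T.IsAcyclic) {C : Ray T} (hC : C.vertex 0 = r)
    {m n : ℕ} (h : m ≤ n) : Below T r (C.vertex m) (C.vertex n) := by
  induction n, h using Nat.le_induction with
  | base => exact .refl _
  | succ n _ ih => exact ih.trans (below_succ hc ha hC n)

theorem le_dist (hc : T.Preconnected) (ha : T.IsAcyclic) {C : Ray T} (hC : C.vertex 0 = r)
    (n : ℕ) : n ≤ T.dist r (C.vertex n) := by
  induction n with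
  | zero => exact Nat.zero_le _
  | succ n ih => exact ih.trans_lt ((below_succ hc ha hC n).dist_lt hc (C.adj n).ne)

theorem below_or_below (hc : T.Preconnected) (ha : T.IsAcyclic) {C : Ray T} (hC : C.vertex 0 = r)
    {x y : V} (hx : x ∈ C.verts) (hy : y ∈ C.verts) : Below T r x y ∨ Below T r y x := by
  obtain ⟨m, rfl⟩ := hx
  obtain ⟨n, rfl⟩ := hy
  exact (le_total m n).imp (below_of_le hc ha hC) (below_of_le hc ha hC)

theorem exists_notMem (C : Ray T) {F : Set V} (hF : F.Finite) (N : ℕ) :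
    ∃ n ≥ N, C.vertex n ∉ F := by
  obtain ⟨n, hn, hn'⟩ := (Set.Ici_infinite N).exists_notMem_finite
    (hF.preimage C.injective.injOn)
  exact ⟨n, hn, hn'⟩

/-- Equivalent rays share arbitrarily late vertices, and a ray from `r` contains all that lies below
any of its vertices. Thus an end has only one ray from `r`. -/
theorem verts_subset_of_toEnd_eq (hc : T.Preconnected) (ha : T.IsAcyclic) {C D : Ray T}
    (hC : C.vertex 0 = r) (hD : D.vertex 0 = r) (h : C.toEnd = D.toEnd) : C.verts ⊆ D.verts := by
  obtain ⟨F, hF, e⟩ := toEnd_eq_iff.1 h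
  rintro _ ⟨m, rfl⟩
  obtain ⟨n, hn, hn'⟩ := C.exists_notMem hF m
  have : C.vertex n ∈ D.verts \ F := e ▸ ⟨⟨n, rfl⟩, hn'⟩
  obtain ⟨⟨k, hk⟩, -⟩ := this
  exact mem_verts_of_below hD (hk ▸ below_of_le hc ha hC hn)

theorem toEnd_mem_endsThrough_iff (hc : T.Preconnected) (ha : T.IsAcyclic) {C : Ray T}
    (hC : C.vertex 0 = r) {s : V} : C.toEnd ∈ endsThrough T r s ↔ s ∈ C.verts := by
  constructor
  · rintro ⟨D, h, hD, hs⟩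
    exact verts_subset_of_toEnd_eq hc ha hD hC h hs
  · exact fun h => ⟨C, rfl, hC, h⟩

end Ray

/-! ### The topology of the end space and branching sets -/

section Ends

variable {V : Type u} {T : SimpleGraph V}

theorem exists_ray_from (hc : T.Preconnected) (ha : T.IsAcyclic) (r : V) (e : Ends T) :
    ∃ C : Ray T, C.vertex 0 = r ∧ C.toEnd = e := by
  obtain ⟨C, rfl⟩ := Quotient.exists_rep e
  -- At a vertex of `C` nearest to `r` the path from `r` can be joined to the tail of `C`: all
  -- earlier vertices of the path are strictly nearer.
  obtain ⟨k, hk⟩ : ∃ k, ∀ n, T.dist r (C.vertex k) ≤ T.dist r (C.vertex n) := by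
    obtain ⟨k, hk⟩ := WellFounded.has_min (measure fun n => T.dist r (C.vertex n)).wf Set.univ
      Set.univ_nonempty
    exact ⟨k, fun n => not_lt.1 (hk.2 n (Set.mem_univ n))⟩
  obtain ⟨p, hp⟩ := exists_isPath hc r (C.vertex k)
  obtain ⟨D, hD, hD'⟩ := (C.tail k).exists_append hp (by simp [Ray.tail]) (by
    intro z hz hz'
    obtain ⟨n, rfl⟩ := C.tail_verts_subset k hz'
    by_contra hne
    exact (hk n).not_gt ((below_of_mem_support ha hp hz).dist_lt hc hne))
  refine ⟨D, hD, Ray.toEnd_eq_iff.2 ⟨{z | z ∈ p.support} ∪ C.vertex '' Set.Iio k,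
    (List.finite_toSet _).union ((Set.finite_Iio k).image _), ?_⟩⟩
  ext z
  have h₁ := @Ray.tail_verts_subset _ _ C k z
  have h₂ := @Ray.verts_subset_tail_verts_union _ _ C k z
  simp only [hD', Set.mem_sdiff, Set.mem_union] at h₂ ⊢
  tauto

/-- For a fixed vertex `r`, the sets `endsThrough T r s` form a basis of the space of ends. -/
theorem exists_endsThrough_subset (hc : T.Preconnected) (ha : T.IsAcyclic) (r : V)
    {U : Set (Ends T)} (hU : IsOpen U) {x : Ends T} (hx : x ∈ U) :
    ∃ s, x ∈ endsThrough T r s ∧ endsThrough T r s ⊆ U := by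
  induction hU with
  | basic U h =>
    obtain ⟨r', s', rfl⟩ := h
    obtain ⟨C', hC', rfl, n₀, rfl⟩ := hx
    obtain ⟨C, hC, e⟩ := exists_ray_from hc ha r C'.toEnd
    rw [← hC'] at *
    obtain ⟨F, hF, hF'⟩ := Ray.toEnd_eq_iff.1 e
    obtain ⟨N, hN⟩ : ∃ N, ∀ z ∈ F ∪ C'.vertex '' Set.Iic n₀, T.dist r z < N := by
      obtain ⟨N, hN⟩ := ((hF.union ((Set.finite_Iic n₀).image C'.vertex)).image
        (T.dist r)).bddAbove
      exact ⟨N + 1, fun z hz => Nat.lt_succ_of_le (hN ⟨z, hz, rfl⟩)⟩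
    have hex : ∃ m, N ≤ T.dist r (C'.vertex m) := by
      obtain ⟨n, hn, hnF⟩ := C.exists_notMem hF N
      have : C.vertex n ∈ C'.verts \ F := hF' ▸ ⟨⟨n, rfl⟩, hnF⟩
      obtain ⟨⟨m, hm⟩, -⟩ := this
      exact ⟨m, hm ▸ hn.le.trans (Ray.le_dist hc ha hC n)⟩
    classical
    -- The first vertex of `C'` at distance at least `N` lies outside `F` and not before `s'`. The
    -- earlier ones are nearer to `r`, so any ray from `r` through this vertex can have its initial
    -- part replaced by that of `C'`.
    obtain ⟨m, hm, hmin⟩ : ∃ m, N ≤ T.dist r (C'.vertex m) ∧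
        ∀ k < m, T.dist r (C'.vertex k) < N :=
      ⟨Nat.find hex, Nat.find_spec hex, fun k hk => not_le.1 (Nat.find_min hex hk)⟩
    have hmF : C'.vertex m ∉ F := fun h => (hN _ (Or.inl h)).not_ge hm
    have hn₀ : n₀ ≤ m := by
      by_contra h
      exact (hN _ (Or.inr ⟨m, (not_le.1 h).le, rfl⟩)).not_ge hm
    have hmC : C'.vertex m ∈ C.verts := by
      have : C'.vertex m ∈ C.verts \ F := hF' ▸ ⟨⟨m, rfl⟩, hmF⟩
      exact this.1
    refine ⟨C'.vertex m, ⟨C, e, hC, hmC⟩, ?_⟩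
    rintro _ ⟨D, rfl, hD, j, hj⟩
    obtain ⟨p, hp, hps⟩ := C'.exists_path m
    obtain ⟨E, hE, hE'⟩ := (D.tail j).exists_append hp (by simpa [Ray.tail] using hj) (by
      intro z hz hz'
      obtain ⟨i, hi⟩ := hz'
      have hb : Below T r (C'.vertex m) z := by
        rw [← hj, ← hi]
        exact Ray.below_of_le hc ha hD (Nat.le_add_left _ _)
      obtain ⟨k, hk, rfl⟩ := (hps z).1 hz
      rcases hk.lt_or_eq with hk | rfl
      · exact absurd (hb.dist_le hc) ((hmin k hk).trans_le hm).not_ge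
      · rfl)
    refine ⟨E, Ray.toEnd_eq_iff.2 ⟨{z | z ∈ p.support} ∪ D.vertex '' Set.Iio j,
      (List.finite_toSet _).union ((Set.finite_Iio j).image _), ?_⟩, hE, ?_⟩
    · ext z
      have h₁ := @Ray.tail_verts_subset _ _ D j z
      have h₂ := @Ray.verts_subset_tail_verts_union _ _ D j z
      simp only [hE', Set.mem_sdiff, Set.mem_union] at h₂ ⊢
      tauto
    · rw [hE']
      exact Or.inl ((hps _).2 ⟨n₀, hn₀, rfl⟩)
  | univ =>
    obtain ⟨C, hC, rfl⟩ := exists_ray_from hc ha r x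
    exact ⟨r, ⟨C, rfl, hC, 0, hC⟩, Set.subset_univ _⟩
  | inter U₁ U₂ _ _ ih₁ ih₂ =>
    obtain ⟨s₁, h₁, h₁'⟩ := ih₁ hx.1
    obtain ⟨s₂, h₂, h₂'⟩ := ih₂ hx.2
    obtain ⟨C, hC, rfl⟩ := exists_ray_from hc ha r x
    have mono : ∀ {s t : V}, Below T r s t → endsThrough T r t ⊆ endsThrough T r s := by
      rintro s _ h _ ⟨D, rfl, hD, n, rfl⟩
      exact ⟨D, rfl, hD, Ray.mem_verts_of_below hD h⟩
    have h₃ := (Ray.toEnd_mem_endsThrough_iff hc ha hC).1 h₁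
    have h₄ := (Ray.toEnd_mem_endsThrough_iff hc ha hC).1 h₂
    rcases Ray.below_or_below hc ha hC h₃ h₄ with h | h
    · exact ⟨s₂, h₂, Set.subset_inter ((mono h).trans h₁') h₂'⟩
    · exact ⟨s₁, h₁, Set.subset_inter h₁' ((mono h).trans h₂')⟩
  | sUnion 𝒰 _ ih =>
    obtain ⟨U, hU, hxU⟩ := hx
    obtain ⟨s, hs, hs'⟩ := ih U hU hxU
    exact ⟨s, hs, hs'.trans (Set.subset_sUnion_of_mem hU)⟩

theorem topologicallyScattered_of_not_branching (hc : T.Preconnected) (ha : T.IsAcyclic) {r : V}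
    (h : ¬ Branching T r) : TopologicallyScattered (Ends T) := by
  intro S hS
  by_contra! hn
  apply h
  refine ⟨{v | ∃ x ∈ S, x ∈ endsThrough T r v}, ?_, ?_⟩
  · obtain ⟨x, hx⟩ := hS
    obtain ⟨C, hC, rfl⟩ := exists_ray_from hc ha r x
    exact ⟨r, _, hx, C, rfl, hC, 0, hC⟩
  · rintro v ⟨x, hx, hxv⟩
    have hne := hn x hx (endsThrough T r v) (TopologicalSpace.isOpen_generateFrom_of_mem ⟨r, v, rfl⟩)
    obtain ⟨y, ⟨hyv, hy⟩, hxy⟩ : ∃ y ∈ endsThrough T r v ∩ S, y ≠ x := by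
      by_contra! hall
      exact hne (Set.eq_singleton_iff_unique_mem.2 ⟨⟨hxv, hx⟩, hall⟩)
    obtain ⟨C, rfl, hC, hvC⟩ := hxv
    obtain ⟨D, rfl, hD, hvD⟩ := hyv
    -- Two rays from `r` through `v` with different ends each have a vertex off the other; such a
    -- vertex cannot be below `v`, as that would put it on both.
    have key : ∀ {C D : Ray T}, C.vertex 0 = r → D.vertex 0 = r → D.toEnd ≠ C.toEnd →
        v ∈ C.verts → v ∈ D.verts → ∃ s ∈ C.verts, s ∉ D.verts ∧ Below T r v s := by
      intro C D hC hD hne hvC hvD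
      obtain ⟨s, hs, hs'⟩ : ∃ s ∈ C.verts, s ∉ D.verts := by
        by_contra! hsub
        have hsub' : D.verts ⊆ C.verts := by
          rintro _ ⟨n, rfl⟩
          -- The index is chosen so that this vertex of `C` is at least as far from `r` as `D.vertex
          -- n`. As it lies on `D` too, `D.vertex n` is below it.
          obtain ⟨k, hk⟩ := hsub _ (C.vertex_mem_verts (T.dist r (D.vertex n)))
          rcases le_total n k with hnk | hkn
          · exact Ray.mem_verts_of_below hC (hk ▸ Ray.below_of_le hc ha hD hnk)
          · have h₁ : Below T r (D.vertex k) (D.vertex n) := Ray.below_of_le hc ha hD hkn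
            have h₂ := Ray.le_dist hc ha hC (T.dist r (D.vertex n))
            rw [← hk] at h₂
            by_cases e : D.vertex k = D.vertex n
            · exact ⟨_, hk.symm.trans e⟩
            · exact absurd (h₁.dist_lt hc e) h₂.not_gt
        exact hne (Ray.toEnd_eq_iff.2 ⟨∅, Set.finite_empty, by rw [hsub'.antisymm hsub]⟩)
      refine ⟨s, hs, hs', (Ray.below_or_below hc ha hC hvC hs).resolve_right fun h => hs' ?_⟩
      obtain ⟨n, rfl⟩ := hvD
      exact Ray.mem_verts_of_below hD h
    obtain ⟨s, hs, hs', hvs⟩ := key hC hD hxy hvC hvD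
    obtain ⟨t, ht, ht', hvt⟩ := key hD hC hxy.symm hvD hvC
    refine ⟨s, ⟨_, hx, C, rfl, hC, hs⟩, t, ⟨_, hy, D, rfl, hD, ht⟩, hvs, hvt, fun h => hs' ?_,
      fun h => ht' ?_⟩
    · obtain ⟨n, rfl⟩ := ht
      exact Ray.mem_verts_of_below hD h
    · obtain ⟨n, rfl⟩ := hs
      exact Ray.mem_verts_of_below hC h

theorem exists_sequence {r : V} {A : Set V}
    (hA : ∀ v ∈ A, ∃ c ∈ A, T.Adj v c ∧ Below T r v c) {v : V} (hv : v ∈ A) :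
    ∃ x : ℕ → V, x 0 = v ∧ ∀ n, x n ∈ A ∧ T.Adj (x n) (x (n + 1)) ∧
      Below T r (x n) (x (n + 1)) := by
  choose! f hf hadj hbel using hA
  have hmem : ∀ n, f^[n] v ∈ A := by
    intro n
    induction n with
    | zero => exact hv
    | succ n ih => rw [Function.iterate_succ_apply']; exact hf _ ih
  refine ⟨fun n => f^[n] v, rfl, fun n => ?_⟩
  simp only [Function.iterate_succ_apply']
  exact ⟨hmem n, hadj _ (hmem n), hbel _ (hmem n)⟩

theorem below_of_le_of_forall_below_succ {r : V} {x : ℕ → V}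
    (h : ∀ n, Below T r (x n) (x (n + 1))) {m n : ℕ} (hmn : m ≤ n) : Below T r (x m) (x n) := by
  induction n, hmn using Nat.le_induction with
  | base => exact .refl _
  | succ n _ ih => exact ih.trans (h n)

theorem strictMono_dist (hc : T.Preconnected) {r : V} {x : ℕ → V}
    (h : ∀ n, T.Adj (x n) (x (n + 1))) (h' : ∀ n, Below T r (x n) (x (n + 1))) :
    StrictMono fun n => T.dist r (x n) :=
  strictMono_nat_of_lt_succ fun n => (h' n).dist_lt hc (h n).ne

/-- A set of vertices that is closed downwards and whose members have children in the set contains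
rays from the root through each of its members. -/
theorem exists_ray_through (hc : T.Preconnected) (ha : T.IsAcyclic) {r : V} {A : Set V}
    (hA : ∀ v ∈ A, ∀ w, Below T r w v → w ∈ A)
    (hA' : ∀ v ∈ A, ∃ c ∈ A, T.Adj v c ∧ Below T r v c) {v : V} (hv : v ∈ A) :
    ∃ C : Ray T, C.vertex 0 = r ∧ v ∈ C.verts ∧ C.verts ⊆ A := by
  obtain ⟨x, rfl, hx⟩ := exists_sequence hA' hv
  have hlt := strictMono_dist hc (fun n => (hx n).2.1) fun n => (hx n).2.2
  let C : Ray T := ⟨x, fun m n h => hlt.injective (congrArg (T.dist r) h), fun n => (hx n).2.1⟩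
  have hCv : ∀ n, Below T r (x 0) (C.vertex n) := fun n =>
    below_of_le_of_forall_below_succ (fun n => (hx n).2.2) (Nat.zero_le n)
  obtain ⟨p, hp⟩ := exists_isPath hc r (x 0)
  obtain ⟨D, hD, hD'⟩ := C.exists_append hp rfl (by
    rintro z hz ⟨n, rfl⟩
    exact (below_of_mem_support ha hp hz).antisymm hc (hCv n))
  refine ⟨D, hD, hD' ▸ Or.inr ⟨0, rfl⟩, ?_⟩
  rw [hD']
  rintro z (hz | ⟨n, rfl⟩)
  · exact hA _ hv _ (below_of_mem_support ha hp hz)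
  · exact (hx n).1

theorem not_branching_of_topologicallyScattered (hc : T.Preconnected) (ha : T.IsAcyclic) (r : V)
    (h : TopologicallyScattered (Ends T)) : ¬ Branching T r := by
  rintro ⟨B, ⟨b₀, hb₀⟩, hB⟩
  have ray : ∀ b ∈ B, ∃ C : Ray T, C.vertex 0 = r ∧ b ∈ C.verts ∧
      C.verts ⊆ {v | ∃ b ∈ B, Below T r v b} := by
    intro b hb
    refine exists_ray_through hc ha ?_ ?_ (show b ∈ {v | ∃ b ∈ B, Below T r v b} from
      ⟨b, hb, .refl b⟩)
    · rintro v ⟨c, hc', hvc⟩ w hwv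
      exact ⟨c, hc', hwv.trans hvc⟩
    · rintro v ⟨d, hd, hvd⟩
      obtain ⟨x, hx, y, hy, h₁, h₂, h₃, h₄⟩ := hB d hd
      have hne : v ≠ x := by
        rintro rfl
        exact h₃ (hvd.trans h₂)
      obtain ⟨c, hvc, hvc', hcx⟩ := exists_child hc ha (hvd.trans h₁) hne
      exact ⟨c, ⟨x, hx, hcx⟩, hvc, hvc'⟩
  obtain ⟨C₀, hC₀, hC₀', hC₀''⟩ := ray b₀ hb₀
  obtain ⟨e, ⟨C, hC, hCB, rfl⟩, U, hU, hUS⟩ :=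
    h {e | ∃ C : Ray T, C.vertex 0 = r ∧ C.verts ⊆ {v | ∃ b ∈ B, Below T r v b} ∧ C.toEnd = e}
      ⟨_, C₀, hC₀, hC₀'', rfl⟩
  have hCU : C.toEnd ∈ U := (hUS.symm ▸ Set.mem_singleton _ : C.toEnd ∈ U ∩ _).1
  obtain ⟨s, hs, hsU⟩ := exists_endsThrough_subset hc ha r hU hCU
  obtain ⟨b, hb, hsb⟩ := hCB ((Ray.toEnd_mem_endsThrough_iff hc ha hC).1 hs)
  obtain ⟨x, hx, y, hy, hbx, hby, hxy, hyx⟩ := hB b hb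
  -- Rays in the downward closure of `B` through members above `b` pass through `s`, so their ends
  -- lie in `U` and equal the isolated end. Both `x` and `y` would then lie on the single ray `C`.
  have key : ∀ x ∈ B, Below T r b x → x ∈ C.verts := by
    intro x hx hbx
    obtain ⟨D, hD, hxD, hDB⟩ := ray x hx
    have hsD : s ∈ D.verts := by
      obtain ⟨n, rfl⟩ := hxD
      exact Ray.mem_verts_of_below hD (hsb.trans hbx)
    have hDU : D.toEnd ∈ ({C.toEnd} : Set (Ends T)) := by
      rw [← hUS]
      exact ⟨hsU ⟨D, rfl, hD, hsD⟩, D, hD, hDB, rfl⟩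
    exact Ray.verts_subset_of_toEnd_eq hc ha hD hC hDU hxD
  exact (Ray.below_or_below hc ha hC (key x hx hbx) (key y hy hby)).elim hxy hyx

end Ends

/-! ## Members of the class have no branching -/

section Attached

variable {V : Type u} {T : SimpleGraph V} {r : V} {U : Type v} {F : SimpleGraph U} {ρ : U}

/-- A tree with root `ρ` is embedded in a rooted tree in such a way that it is attached to the rest
at `ρ` only. -/
structure AttachedAt (r : V) (ρ : U) (e : F ↪g T) : Prop where
  boundary : ∀ a ∈ Set.range e, ∀ b ∉ Set.range e, T.Adj a b → a = e ρ
  root : r ∈ Set.range e → r = e ρ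

/-- The image of the path from `ρ` to `y` is the path from `e ρ` to `e y`, and `e ρ` is below the
whole copy; both orders are read off from that path. -/
theorem AttachedAt.below_iff {e : F ↪g T} (h : AttachedAt r ρ e) (hc : T.Preconnected)
    (ha : T.IsAcyclic) (hcF : F.Preconnected) (haF : F.IsAcyclic) {x y : U} :
    Below T r (e x) (e y) ↔ Below F ρ x y := by
  have hρ : ∀ z, Below T r (e ρ) (e z) := fun z => below_of_boundary h.boundary h.root ⟨z, rfl⟩
  obtain ⟨p, hp⟩ := exists_isPath hcF ρ y
  have h₁ := mem_support_iff_below (w := e x) hc ha (hρ y) (p := p.map e.toHom) (hp.map e.injective)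
  have h₂ := mem_support_iff_below (w := x) hcF haF (root_below y) hp
  have h₃ : e x ∈ (p.map e.toHom).support ↔ x ∈ p.support := by
    rw [Walk.support_map]
    exact List.mem_map_of_injective e.injective
  rw [h₃, h₂] at h₁
  exact ⟨fun h => (h₁.2 ⟨hρ x, h⟩).2, fun h => (h₁.1 ⟨root_below x, h⟩).2⟩

/-- The chain `S` cannot contain all of a branching set. Above a member outside `S` the set stays in
one attached copy, where its trace branches again. -/
theorem not_branching_of_attached (hc : T.Preconnected) (ha : T.IsAcyclic) (S : Set V)
    (hS : ∀ x ∈ S, ∀ y ∈ S, Below T r x y ∨ Below T r y x)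
    (h : ∀ x ∉ S, ∃ (F : RootedTree.{u}) (e : F.graph ↪g T) (ρ y : F.V), AttachedAt r ρ e ∧
      e y = x ∧ y ≠ ρ ∧ ¬ Branching F.graph ρ) : ¬ Branching T r := by
  rintro ⟨B, ⟨b, hb⟩, hB⟩
  obtain ⟨x, hxB, hxS⟩ : ∃ x ∈ B, x ∉ S := by
    obtain ⟨c, hcB, d, hdB, -, -, h₁, h₂⟩ := hB b hb
    by_contra! hall
    exact (hS c (hall c hcB) d (hall d hdB)).elim h₁ h₂
  obtain ⟨F, e, ρ, y, hat, rfl, hyρ, hF⟩ := h x hxS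
  have hiff := fun x y => hat.below_iff hc ha F.preconnected F.isAcyclic (x := x) (y := y)
  have hmem : ∀ z, Below T r (e y) z → z ∈ Set.range e := fun z hz =>
    mem_of_below_of_boundary hc hat.boundary hat.root ⟨y, rfl⟩ (e.injective.ne hyρ) hz
  refine hF ⟨{z | e z ∈ B ∧ Below T r (e y) (e z)}, ⟨y, hxB, .refl _⟩, ?_⟩
  rintro z ⟨hz, hyz⟩
  obtain ⟨c, hcB, d, hdB, h₁, h₂, h₃, h₄⟩ := hB _ hz
  obtain ⟨c, rfl⟩ := hmem c (hyz.trans h₁)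
  obtain ⟨d, rfl⟩ := hmem d (hyz.trans h₂)
  rw [hiff] at h₃ h₄
  exact ⟨c, ⟨hcB, hyz.trans h₁⟩, d, ⟨hdB, hyz.trans h₂⟩, (hiff _ _).1 h₁, (hiff _ _).1 h₂, h₃, h₄⟩

end Attached

theorem RootedTree.exists_root (T : RootedTree.{u}) (x : T.V) : ∃ r, T.root = some r := by
  rw [← Option.ne_none_iff_exists']
  exact fun h => (T.isEmpty_of_root_eq_none h).false x

/-- No set of vertices of the rooted tree branches. -/
def RootedTree.Unbranched (T : RootedTree.{u}) : Prop :=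
  ∀ r, T.root = some r → ¬ Branching T.graph r

theorem IsSuc.unbranched {T T' : RootedTree.{u}} (h : IsSuc T T') (h' : T'.Unbranched) :
    T.Unbranched := by
  obtain ⟨a, e, hroot, hne, hcov, hadj⟩ := h
  intro r hr
  obtain rfl : a = r := Option.some_injective _ (hroot.symm.trans hr)
  refine not_branching_of_attached T.preconnected T.isAcyclic
    {x | x = a ∨ ∃ ρ, T'.root = some ρ ∧ x = e ρ} ?_ ?_
  · rintro x (rfl | ⟨ρ, hρ, rfl⟩) y (rfl | ⟨ρ', hρ', rfl⟩)
    · exact Or.inl (.refl _)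
    · exact Or.inl (root_below _)
    · exact Or.inr (root_below _)
    · obtain rfl : ρ = ρ' := Option.some_injective _ (hρ.symm.trans hρ')
      exact Or.inl (.refl _)
  · intro x hx
    obtain ⟨y, rfl⟩ := (hcov x).resolve_left fun h => hx (Or.inl h)
    obtain ⟨ρ, hρ⟩ := T'.exists_root y
    refine ⟨T', e, ρ, y, ⟨?_, ?_⟩, rfl, ?_, h' ρ hρ⟩
    · rintro _ ⟨z, rfl⟩ b hb hzb
      obtain rfl := (hcov b).resolve_right hb
      rw [(Option.some_injective _ (hρ.symm.trans ((hadj z).1 hzb.symm)))]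
    · rintro ⟨z, hz⟩
      exact absurd hz (hne z)
    · rintro rfl
      exact hx (Or.inr ⟨_, hρ, rfl⟩)

theorem IsSup.unbranched {T : RootedTree.{u}} {I : Type u} {F : I → RootedTree.{u}}
    (h : IsSup T F) (h' : ∀ i, (F i).Unbranched) : T.Unbranched := by
  obtain ⟨e, hroot, hcov, hdisj, hadj⟩ := h
  intro r hr
  refine not_branching_of_attached T.preconnected T.isAcyclic {r} ?_ ?_
  · rintro x rfl y rfl
    exact Or.inl (.refl _)
  · intro x hx
    obtain ⟨i, y, rfl⟩ := hcov x
    obtain ⟨ρ, hρ⟩ := (F i).exists_root y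
    have hrρ : r = e i ρ := Option.some_injective _ (hr.symm.trans (hroot i ρ hρ))
    refine ⟨F i, e i, ρ, y, ⟨?_, fun _ => hrρ⟩, rfl, ?_, h' i ρ hρ⟩
    · rintro _ ⟨z, rfl⟩ b hb hzb
      obtain ⟨j, y, y', hy, rfl⟩ := hadj _ _ hzb
      have hij : i ≠ j := by
        rintro rfl
        exact hb ⟨y', rfl⟩
      rw [← hrρ]
      exact Option.some_injective _ ((hdisj i j z y hij hy.symm).symm.trans hr)
    · rintro rfl
      exact hx hrρ.symm

theorem IsPathSum.unbranched {T : RootedTree.{u}} {F : ℕ → RootedTree.{u}}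
    (h : IsPathSum T F) (h' : ∀ i, (F i).Unbranched) : T.Unbranched := by
  obtain ⟨-, e, hroot, hcov, hdisj, hadj⟩ := h
  intro r hr
  obtain ⟨ρ₀, hρ₀, rfl⟩ := Option.map_eq_some_iff.1 (hroot.symm.trans hr)
  -- The copies from `m` on together meet the rest of the tree only at the root of the `m`-th copy.
  have hroots : ∀ m n ρ ρ', (F m).root = some ρ → (F n).root = some ρ' → m ≤ n →
      Below T.graph (e 0 ρ₀) (e m ρ) (e n ρ') := by
    intro m n ρ ρ' hρ hρ' hmn
    refine below_of_boundary (A := {x | ∃ k ≥ m, ∃ y, x = e k y}) ?_ ?_ ⟨n, hmn, ρ', rfl⟩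
    · rintro _ ⟨k, hk, y, rfl⟩ b hb hyb
      obtain ⟨l, z, rfl⟩ := hcov b
      have hl : ¬ m ≤ l := fun hl => hb ⟨l, hl, z, rfl⟩
      obtain ⟨h₁, h₂, -⟩ := (hadj k l y z (by omega)).1 hyb
      obtain rfl : k = m := by omega
      rw [Option.some_injective _ (hρ.symm.trans h₂)]
    · rintro ⟨k, hk, y, hy⟩
      obtain rfl : k = 0 := by
        by_contra hk0
        exact hdisj 0 k ρ₀ y (Ne.symm hk0) hy
      obtain rfl : m = 0 := by omega
      rw [Option.some_injective _ (hρ₀.symm.trans hρ)]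
  refine not_branching_of_attached T.preconnected T.isAcyclic
    {x | ∃ n ρ, (F n).root = some ρ ∧ x = e n ρ} ?_ ?_
  · rintro _ ⟨m, ρ, hρ, rfl⟩ _ ⟨n, ρ', hρ', rfl⟩
    exact (le_total m n).imp (hroots _ _ _ _ hρ hρ') (hroots _ _ _ _ hρ' hρ)
  · intro x hx
    obtain ⟨n, y, rfl⟩ := hcov x
    obtain ⟨ρ, hρ⟩ := (F n).exists_root y
    refine ⟨F n, e n, ρ, y, ⟨?_, ?_⟩, rfl, ?_, h' n ρ hρ⟩
    · rintro _ ⟨z, rfl⟩ b hb hzb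
      obtain ⟨l, w, rfl⟩ := hcov b
      have hnl : n ≠ l := by
        rintro rfl
        exact hb ⟨w, rfl⟩
      obtain ⟨-, h₂, -⟩ := (hadj n l z w hnl).1 hzb
      rw [Option.some_injective _ (hρ.symm.trans h₂)]
    · rintro ⟨z, hz⟩
      obtain rfl : n = 0 := by
        by_contra hn
        exact hdisj n 0 z ρ₀ hn hz
      rw [Option.some_injective _ (hρ.symm.trans hρ₀)]
    · rintro rfl
      exact hx ⟨n, _, hρ, rfl⟩

theorem SucSupClosure.unbranched {X : Set RootedTree.{u}} (hX : ∀ T ∈ X, T.Unbranched)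
    {T : RootedTree.{u}} (h : SucSupClosure X T) : T.Unbranched := by
  induction h with
  | base T hT => exact hX T hT
  | suc T T' h _ ih => exact h.unbranched ih
  | sup T I F h _ ih => exact h.unbranched ih

theorem unbranched_of_mem_rootedClass (α : Ordinal.{u}) :
    ∀ T ∈ rootedClass α, T.Unbranched := by
  induction α using Ordinal.limitRecOn with
  | zero =>
    rw [rootedClass_zero]
    exact fun T hT => SucSupClosure.unbranched (fun T hT r _ => (hT.false r).elim) hT
  | add_one β ih =>
    rw [rootedClass_add_one]
    refine fun T hT => SucSupClosure.unbranched ?_ hT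
    rintro T ⟨F, hF, hT⟩
    exact hT.unbranched fun n => ih _ (hF n)
  | limit α h ih =>
    rw [rootedClass_limit α h]
    refine fun T hT => SucSupClosure.unbranched ?_ hT
    rintro T ⟨β, hβ, hT⟩
    exact ih β hβ T hT

/-! ## The hierarchy is increasing -/

/-- Gives closure under successors and sups at all stages alike. -/
theorem exists_rootedClass_eq (α : Ordinal.{u}) :
    ∃ X : Set RootedTree.{u}, rootedClass α = {T | SucSupClosure X T} := by
  induction α using Ordinal.limitRecOn with
  | zero => exact ⟨_, rootedClass_zero⟩
  | add_one β ih => exact ⟨_, rootedClass_add_one β⟩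
  | limit α h ih => exact ⟨_, rootedClass_limit α h⟩

theorem IsSuc.mem_rootedClass {α : Ordinal.{u}} {T T' : RootedTree.{u}} (h : IsSuc T T')
    (h' : T' ∈ rootedClass α) : T ∈ rootedClass α := by
  obtain ⟨X, hX⟩ := exists_rootedClass_eq α
  rw [hX] at h' ⊢
  exact .suc T T' h h'

theorem IsSup.mem_rootedClass {α : Ordinal.{u}} {T : RootedTree.{u}} {I : Type u}
    {F : I → RootedTree.{u}} (h : IsSup T F) (h' : ∀ i, F i ∈ rootedClass α) :
    T ∈ rootedClass α := by
  obtain ⟨X, hX⟩ := exists_rootedClass_eq α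
  rw [hX] at h' ⊢
  exact .sup T I F h h'

/-- The empty tree. -/
def emptyTree : RootedTree.{u} where
  V := PEmpty
  graph := ⊥
  preconnected x := x.elim
  isAcyclic := isAcyclic_bot
  root := none
  isEmpty_of_root_eq_none _ := inferInstance

theorem emptyTree_mem_rootedClass (α : Ordinal.{u}) : emptyTree ∈ rootedClass α :=
  IsSup.mem_rootedClass (I := PEmpty) (F := fun _ => emptyTree)
    ⟨fun i => i.elim, fun i => i.elim, fun x => x.elim, fun i => i.elim, fun x => x.elim⟩
    fun i => i.elim

/-- The empty tree embeds in every graph. -/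
def emptyTreeEmbedding {V : Type v} (G : SimpleGraph V) : emptyTree.{u}.graph ↪g G :=
  ⟨⟨PEmpty.elim, fun x => x.elim⟩, fun {x} => x.elim⟩

theorem isPathSum_single (T : RootedTree.{u}) :
    IsPathSum T (fun n => match n with | 0 => T | _ + 1 => emptyTree) := by
  refine ⟨fun n _ => inferInstanceAs (IsEmpty PEmpty), fun n => match n with
    | 0 => .refl
    | n + 1 => emptyTreeEmbedding _, ?_, fun x => ⟨0, x, rfl⟩, ?_, ?_⟩
  · exact (Option.map_id' (x := T.root)).symm
  · rintro (_ | m) (_ | n) y z h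
    · exact absurd rfl h
    · exact z.elim
    · exact y.elim
    · exact y.elim
  · rintro (_ | m) (_ | n) y z h
    · exact absurd rfl h
    · exact z.elim
    · exact y.elim
    · exact y.elim

theorem rootedClass_mono {α β : Ordinal.{u}} (h : α ≤ β) :
    rootedClass α ⊆ rootedClass β := by
  induction β using Ordinal.limitRecOn with
  | zero =>
    rw [nonpos_iff_eq_zero.1 h]
  | add_one β ih =>
    rcases h.eq_or_lt with rfl | h
    · rfl
    · intro T hT
      rw [rootedClass_add_one]
      refine .base T ⟨_, ?_, isPathSum_single T⟩
      rintro (_ | n)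
      · exact ih (Order.lt_add_one_iff.1 h) hT
      · exact emptyTree_mem_rootedClass β
  | limit β hβ ih =>
    rcases h.eq_or_lt with rfl | h
    · rfl
    · intro T hT
      rw [rootedClass_limit β hβ]
      exact .base T ⟨α, h, hT⟩

/-! ## Decomposition of trees without branching -/

section Decomposition

variable {V : Type u} {T : SimpleGraph V} {r : V}

/-- `A` is the vertex set of a subtree whose least vertex is `v`. -/
structure RootedAt (T : SimpleGraph V) (r v : V) (A : Set V) : Prop where
  mem : v ∈ A
  below : ∀ a ∈ A, Below T r v a
  convex : ∀ a ∈ A, ∀ x, Below T r v x → Below T r x a → x ∈ A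

/-- The subtree with a given vertex set, rooted at its least vertex. -/
def RootedAt.tree {v : V} {A : Set V} (h : RootedAt T r v A) (hc : T.Preconnected)
    (ha : T.IsAcyclic) : RootedTree.{u} where
  V := A
  graph := T.induce A
  preconnected := by
    have key : ∀ x : A, (T.induce A).Reachable ⟨v, h.mem⟩ x := by
      rintro ⟨x, hx⟩
      obtain ⟨p, hp⟩ := exists_isPath hc v x
      refine ⟨p.induce A fun y hy => ?_⟩
      have := (mem_support_iff_below hc ha (h.below x hx) hp).1 hy
      exact h.convex x hx y this.1 this.2
    exact fun x y => (key x).symm.trans (key y)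
  isAcyclic := ha.induce A
  root := some ⟨v, h.mem⟩
  isEmpty_of_root_eq_none h := by simp at h

theorem rootedAt_above (v : V) : RootedAt T r v {x | Below T r v x} :=
  ⟨.refl v, fun _ h => h, fun _ _ _ h _ => h⟩

/-- The subtree of all vertices above a given vertex. -/
def treeAbove (hc : T.Preconnected) (ha : T.IsAcyclic) (r v : V) : RootedTree.{u} :=
  (rootedAt_above (r := r) v).tree hc ha

theorem rootedAt_singleton (hc : T.Preconnected) (v : V) : RootedAt T r v {v} := by
  refine ⟨rfl, ?_, ?_⟩
  · rintro _ rfl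
    exact .refl _
  · rintro _ rfl x h₁ h₂
    exact h₂.antisymm hc h₁

theorem rootedAt_insert (hc : T.Preconnected) {v c : V} (hvc : T.Adj v c) (h : Below T r v c) :
    RootedAt T r v (insert v {x | Below T r c x}) := by
  refine ⟨Or.inl rfl, ?_, ?_⟩
  · rintro _ (rfl | hx)
    exacts [.refl _, h.trans hx]
  · rintro a (rfl | hca) x hvx hxa
    · exact Or.inl (hxa.antisymm hc hvx)
    · by_cases hcx : Below T r c x
      · exact Or.inr hcx
      · have hxc : Below T r x c := (hxa.total hc hca).resolve_right hcx
        have hne : x ≠ c := by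
          rintro rfl
          exact hcx (.refl _)
        exact Or.inl ((Below.of_adj hvc hxc hne).antisymm hc hvx)

theorem isSuc_singleton (hc : T.Preconnected) (ha : T.IsAcyclic) (v : V) :
    IsSuc ((rootedAt_singleton (T := T) (r := r) hc v).tree hc ha) emptyTree :=
  ⟨⟨v, rfl⟩, emptyTreeEmbedding _, rfl, fun y => y.elim,
    fun x => Or.inl (Subtype.ext x.2), fun y => y.elim⟩

theorem isSuc_insert (hc : T.Preconnected) (ha : T.IsAcyclic) {v c : V} (hvc : T.Adj v c)
    (h : Below T r v c) : IsSuc ((rootedAt_insert hc hvc h).tree hc ha) (treeAbove hc ha r c) := by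
  refine ⟨⟨v, Or.inl rfl⟩, T.induceHomOfLE (Set.subset_insert _ _), rfl, ?_, ?_, ?_⟩
  · rintro ⟨y, hy⟩ e
    obtain rfl : y = v := congrArg Subtype.val e
    exact hvc.ne (h.antisymm hc hy)
  · rintro ⟨x, rfl | hx⟩
    · exact Or.inl rfl
    · exact Or.inr ⟨⟨x, hx⟩, rfl⟩
  · rintro ⟨y, hy⟩
    constructor
    · intro hvy
      have hvy : T.Adj v y := hvy
      have : c = y := by
        by_contra hne
        exact hvc.ne (h.antisymm hc (Below.of_adj hvy hy hne))
      subst this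
      rfl
    · intro e
      obtain rfl : c = y := congrArg Subtype.val (Option.some_injective _ e)
      exact hvc

theorem RootedAt.isSup (hc : T.Preconnected) (ha : T.IsAcyclic) {v : V} {A : Set V}
    (hA : RootedAt T r v A) {I : Type u} {B : I → Set V} (hB : ∀ i, RootedAt T r v (B i))
    (hBA : ∀ i, B i ⊆ A) (hcov : ∀ x ∈ A, ∃ i, x ∈ B i)
    (hdisj : ∀ i j, i ≠ j → ∀ x ∈ B i, x ∈ B j → x = v)
    (hadj : ∀ x ∈ A, ∀ y ∈ A, T.Adj x y → ∃ i, x ∈ B i ∧ y ∈ B i) :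
    IsSup (hA.tree hc ha) fun i => (hB i).tree hc ha := by
  refine ⟨fun i => T.induceHomOfLE (hBA i), ?_, ?_, ?_, ?_⟩
  · intro i y hy
    obtain rfl := Option.some_injective _ hy
    rfl
  · rintro ⟨x, hx⟩
    obtain ⟨i, hi⟩ := hcov x hx
    exact ⟨i, ⟨x, hi⟩, rfl⟩
  · rintro i j ⟨y, hy⟩ ⟨z, hz⟩ hij e
    obtain rfl : y = z := congrArg Subtype.val e
    obtain rfl := hdisj i j hij y hy hz
    rfl
  · rintro ⟨x, hx⟩ ⟨y, hy⟩ h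
    obtain ⟨i, hxi, hyi⟩ := hadj x hx y hy h
    exact ⟨i, ⟨x, hxi⟩, ⟨y, hyi⟩, rfl, rfl⟩

/-- A tree is in a class if it consists of its root and of trees of the class above some children
of the root. -/
theorem RootedAt.mem_rootedClass (hc : T.Preconnected) (ha : T.IsAcyclic) {v : V} {A K : Set V}
    (hA : RootedAt T r v A) (hK : ∀ c ∈ K, T.Adj v c ∧ Below T r v c)
    (hAK : ∀ x, x ∈ A ↔ x = v ∨ ∃ c ∈ K, Below T r c x) {α : Ordinal.{u}}
    (hα : ∀ c ∈ K, treeAbove hc ha r c ∈ rootedClass α) : hA.tree hc ha ∈ rootedClass α := by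
  -- The index `none` supplies the bare root, since a sup over an empty `K` would be the empty tree.
  let B : Option K → Set V := fun i => i.elim {v} fun c => insert v {x | Below T r c x}
  have hB : ∀ i, RootedAt T r v (B i) := by
    rintro (_ | c)
    · exact rootedAt_singleton hc v
    · exact rootedAt_insert hc (hK c c.2).1 (hK c c.2).2
  have hKv : ∀ c ∈ K, ¬ Below T r c v := fun c hcK h =>
    (hK c hcK).1.ne ((hK c hcK).2.antisymm hc h)
  have up : ∀ x ∈ A, ∀ y ∈ A, T.Adj x y → Below T r x y → ∃ i, x ∈ B i ∧ y ∈ B i := by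
    intro x hx y hy hxy h
    rcases (hAK y).1 hy with rfl | ⟨c, hcK, hcy⟩
    · exact absurd (h.antisymm hc (hA.below x hx)) hxy.ne
    · refine ⟨some ⟨c, hcK⟩, ?_, Or.inr hcy⟩
      by_cases e : c = y
      · subst e
        exact Or.inl (Below.parent_unique hc hxy h (hK c hcK).1 (hK c hcK).2)
      · exact Or.inr (Below.of_adj hxy hcy e)
  refine IsSup.mem_rootedClass (hA.isSup hc ha hB ?_ ?_ ?_ ?_) ?_
  · rintro (_ | ⟨c, hcK⟩) x hx
    · exact (hAK x).2 (Or.inl hx)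
    · rcases hx with hx | hx
      · exact (hAK x).2 (Or.inl hx)
      · exact (hAK x).2 (Or.inr ⟨c, hcK, hx⟩)
  · intro x hx
    rcases (hAK x).1 hx with rfl | ⟨c, hcK, hcx⟩
    · exact ⟨none, rfl⟩
    · exact ⟨some ⟨c, hcK⟩, Or.inr hcx⟩
  · rintro (_ | ⟨c, hcK⟩) (_ | ⟨d, hdK⟩) hne x hx hx'
    · exact hx
    · exact hx
    · exact hx'
    · rcases hx with hx | hx
      · exact hx
      rcases hx' with hx' | hx'
      · exact hx'
      refine absurd ?_ hne
      obtain rfl := child_unique hc (hK c hcK).1 (hK c hcK).2 (hK d hdK).1 (hK d hdK).2 hx hx'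
      rfl
  · intro x hx y hy hxy
    rcases below_or_below_of_adj (r := r) hc ha hxy with h | h
    · exact up x hx y hy hxy h
    · obtain ⟨i, h₁, h₂⟩ := up y hy x hx hxy.symm h
      exact ⟨i, h₂, h₁⟩
  · rintro (_ | ⟨c, hcK⟩)
    · exact (isSuc_singleton hc ha v).mem_rootedClass (emptyTree_mem_rootedClass α)
    · exact (isSuc_insert hc ha (hK c hcK).1 (hK c hcK).2).mem_rootedClass (hα c hcK)

theorem rootedAt_between (hc : T.Preconnected) {v w : V} (hvw : T.Adj v w) (h : Below T r v w) :
    RootedAt T r v {x | Below T r v x ∧ ¬ Below T r w x} :=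
  ⟨⟨.refl v, fun h' => hvw.ne (h.antisymm hc h')⟩, fun _ h => h.1,
    fun _ ha _ hvx hxa => ⟨hvx, fun hwx => ha.2 (hwx.trans hxa)⟩⟩

/-- The tree above the origin of an increasing sequence is the sum of the trees between consecutive
members of the sequence. -/
theorem isPathSum_treeAbove (hc : T.Preconnected) (ha : T.IsAcyclic) {x : ℕ → V}
    (hx : ∀ n, T.Adj (x n) (x (n + 1))) (hx' : ∀ n, Below T r (x n) (x (n + 1))) :
    IsPathSum (treeAbove hc ha r (x 0))
      fun n => (rootedAt_between hc (hx n) (hx' n)).tree hc ha := by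
  have hle : ∀ {m n}, m ≤ n → Below T r (x m) (x n) :=
    below_of_le_of_forall_below_succ hx'
  have hinj : ∀ {m n y}, Below T r (x m) y → ¬ Below T r (x (m + 1)) y → Below T r (x n) y →
      ¬ Below T r (x (n + 1)) y → m = n := by
    intro m n y h₁ h₂ h₃ h₄
    by_contra hne
    rcases lt_or_gt_of_ne hne with h | h
    · exact h₂ ((hle h).trans h₃)
    · exact h₄ ((hle h).trans h₁)
  -- An edge that leads up into another piece must end at the least vertex `x n` of that piece,
  -- whose parent is the preceding vertex of the sequence.
  have hsucc : ∀ {m n y z}, m ≠ n → Below T r (x m) y → ¬ Below T r (x (m + 1)) y →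
      Below T r (x n) z → ¬ Below T r (x (n + 1)) z → T.Adj y z → Below T r y z →
      n = m + 1 ∧ y = x m ∧ z = x n := by
    intro m n y z hmn h₁ h₂ h₃ h₄ hyz hb
    have hz : x n = z := by
      by_contra hne
      have h₅ : Below T r (x n) y := Below.of_adj hyz h₃ hne
      exact hmn (hinj h₁ h₂ h₅ fun h => h₄ (h.trans hb))
    subst hz
    cases n with
    | zero => exact absurd (hb.antisymm hc ((hle (Nat.zero_le m)).trans h₁)) hyz.ne
    | succ n =>
      obtain rfl : y = x n := Below.parent_unique hc hyz hb (hx n) (hx' n)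
      have : m = n := hinj h₁ h₂ (.refl _) fun h => (hx n).ne ((hx' n).antisymm hc h)
      subst this
      exact ⟨rfl, rfl, rfl⟩
  refine ⟨fun n h => (h.false ⟨x n, (rootedAt_between hc (hx n) (hx' n)).mem⟩).elim,
    fun n => T.induceHomOfLE fun y hy => (hle (Nat.zero_le n)).trans hy.1,
    rfl, ?_, ?_, ?_⟩
  · rintro ⟨y, hy⟩
    -- The distances of the `x n` from `r` grow without bound, so only finitely many are below `y`;
    -- the last of them determines the piece of `y`.
    have hex : ∃ n, ¬ Below T r (x n) y := by
      refine ⟨T.dist r y + 1, fun h => ?_⟩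
      have h₁ := h.dist_le hc
      have h₂ := (strictMono_dist hc hx hx').id_le (T.dist r y + 1)
      simp only [id] at h₂
      omega
    classical
    obtain ⟨n, hn⟩ : ∃ n, Nat.find hex = n + 1 := by
      refine Nat.exists_eq_succ_of_ne_zero fun h => ?_
      have := Nat.find_spec hex
      rw [h] at this
      exact this hy
    refine ⟨n, ⟨y, ?_, ?_⟩, rfl⟩
    · exact not_not.1 (Nat.find_min hex (by omega))
    · rw [← hn]
      exact Nat.find_spec hex
  · rintro m n ⟨y, hy⟩ ⟨z, hz⟩ hmn e
    obtain rfl : y = z := congrArg Subtype.val e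
    exact hmn (hinj hy.1 hy.2 hz.1 hz.2)
  · rintro m n ⟨y, hy⟩ ⟨z, hz⟩ hmn
    constructor
    · intro h
      have h : T.Adj y z := h
      rcases below_or_below_of_adj (r := r) hc ha h with hb | hb
      · obtain ⟨h₁, rfl, rfl⟩ := hsucc hmn hy.1 hy.2 hz.1 hz.2 h hb
        exact ⟨Or.inl h₁, rfl, rfl⟩
      · obtain ⟨h₁, rfl, rfl⟩ := hsucc hmn.symm hz.1 hz.2 hy.1 hy.2 h.symm hb
        exact ⟨Or.inr h₁, rfl, rfl⟩
    · rintro ⟨h, e₁, e₂⟩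
      obtain rfl : x m = y := congrArg Subtype.val (Option.some_injective _ e₁)
      obtain rfl : x n = z := congrArg Subtype.val (Option.some_injective _ e₂)
      rcases h with rfl | rfl
      · exact hx m
      · exact (hx n).symm

theorem exists_treeAbove_mem_rootedClass (hc : T.Preconnected) (ha : T.IsAcyclic)
    (h : ¬ Branching T r) (v : V) : ∃ α : Ordinal.{u}, treeAbove hc ha r v ∈ rootedClass α := by
  by_contra hv
  -- One stage serves all good vertices, because they form a set in the universe of the ordinals and
  -- the classes increase.
  obtain ⟨α, hα⟩ : ∃ α : Ordinal.{u}, ∀ c,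
      (∃ α : Ordinal.{u}, treeAbove hc ha r c ∈ rootedClass α) →
        treeAbove hc ha r c ∈ rootedClass α := by
    choose! f hf using fun (c : V) (h : ∃ α : Ordinal.{u}, treeAbove hc ha r c ∈ rootedClass α) => h
    exact ⟨⨆ c, f c, fun c h => rootedClass_mono (Ordinal.le_iSup f c) (hf c h)⟩
  apply h
  refine ⟨{v | ¬ ∃ α : Ordinal.{u}, treeAbove hc ha r v ∈ rootedClass α}, ⟨v, hv⟩, ?_⟩
  intro b hb
  by_contra! hchain
  -- By `hchain` the bad vertices above `b` are pairwise comparable. All children of a maximal bad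
  -- vertex are good.
  by_cases hmax : ∃ m, (¬ ∃ α : Ordinal.{u}, treeAbove hc ha r m ∈ rootedClass α) ∧
      ∀ y, (¬ ∃ α : Ordinal.{u}, treeAbove hc ha r y ∈ rootedClass α) →
        Below T r m y → y = m
  · obtain ⟨m, hm, hmax⟩ := hmax
    refine hm ⟨α, RootedAt.mem_rootedClass hc ha (rootedAt_above m)
      (K := {c | T.Adj m c ∧ Below T r m c}) (fun c h => h) (fun x => ⟨fun hx => ?_, ?_⟩) ?_⟩
    · by_cases e : m = x
      · exact Or.inl e.symm
      · obtain ⟨c, h₁, h₂, h₃⟩ := exists_child hc ha hx e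
        exact Or.inr ⟨c, ⟨h₁, h₂⟩, h₃⟩
    · rintro (rfl | ⟨c, hcm, hcx⟩)
      exacts [.refl _, hcm.2.trans hcx]
    · intro c hcm
      refine hα c (by_contra fun hn => ?_)
      exact hcm.1.ne (hmax c hn hcm.2).symm
  · push Not at hmax
    -- The sequence runs through vertices below bad ones; its members need not be known to be bad.
    obtain ⟨x, rfl, hx⟩ := exists_sequence (T := T) (r := r)
      (A := {v | Below T r b v ∧ ∃ m, (¬ ∃ α : Ordinal.{u}, treeAbove hc ha r m ∈ rootedClass α) ∧
        Below T r v m}) (by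
      rintro v ⟨hbv, m, hm, hvm⟩
      obtain ⟨y, hy, hmy, hne⟩ := hmax m (not_exists.1 hm)
      have hvy : v ≠ y := by
        rintro rfl
        exact hne (hvm.antisymm hc hmy)
      obtain ⟨c, h₁, h₂, h₃⟩ := exists_child hc ha (hvm.trans hmy) hvy
      exact ⟨c, ⟨hbv.trans h₂, y, not_exists.2 hy, h₃⟩, h₁, h₂⟩) ⟨.refl b, b, hb, .refl b⟩
    refine hb ⟨α + 1, ?_⟩
    rw [rootedClass_add_one]
    refine .base _ ⟨_, fun n => ?_,
      isPathSum_treeAbove hc ha (fun n => (hx n).2.1) fun n => (hx n).2.2⟩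
    have hadj := (hx n).2.1
    have hbel := (hx n).2.2
    refine RootedAt.mem_rootedClass hc ha _
      (K := {c | (T.Adj (x n) c ∧ Below T r (x n) c) ∧ c ≠ x (n + 1)}) (fun c h => h.1)
      (fun y => ⟨?_, ?_⟩) ?_
    · rintro ⟨h₁, h₂⟩
      by_cases e : x n = y
      · exact Or.inl e.symm
      · obtain ⟨c, h₃, h₄, h₅⟩ := exists_child hc ha h₁ e
        refine Or.inr ⟨c, ⟨⟨h₃, h₄⟩, ?_⟩, h₅⟩
        rintro rfl
        exact h₂ h₅
    · rintro (rfl | ⟨c, ⟨hc', hne⟩, hcy⟩)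
      · exact (rootedAt_between hc hadj hbel).mem
      · exact ⟨hc'.2.trans hcy, fun h => hne (child_unique hc hc'.1 hc'.2 hadj hbel hcy h)⟩
    · rintro c ⟨⟨h₁, h₂⟩, hne⟩
      refine hα c (by_contra fun hn => hne ?_)
      obtain ⟨⟨h₃, m, hm, h₄⟩, -⟩ := hx (n + 1)
      have h₅ := (hx n).1.1.trans h₂
      -- A bad child `c` off the sequence would be comparable with the bad `m` above `x (n + 1)`;
      -- either way `c` and `x (n + 1)` have a common upper bound and coincide.
      by_cases hcm : Below T r c m
      · exact child_unique hc h₁ h₂ hadj hbel hcm h₄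
      · have hmc := hchain c (not_exists.1 hn) m (not_exists.1 hm) h₅ (h₃.trans h₄) hcm
        exact child_unique hc h₁ h₂ hadj hbel (.refl c) (h₄.trans hmc)

theorem inClassD_of_not_branching (hc : T.Preconnected) (ha : T.IsAcyclic)
    (h : ¬ Branching T r) : InClassD T := by
  obtain ⟨α, hα⟩ := exists_treeAbove_mem_rootedClass hc ha h r
  exact ⟨α, _, hα, ⟨⟨Equiv.subtypeUnivEquiv root_below, Iff.rfl⟩⟩⟩

theorem isScattered_of_isEmpty [IsEmpty V] : IsScattered T :=
  fun _ _ ⟨S⟩ => ⟨fun f => isEmptyElim (f (S.branch []))⟩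

theorem InClassD.isScattered (h : InClassD T) : IsScattered T := by
  obtain ⟨α, R, hR, ⟨f⟩⟩ := h
  have hs : IsScattered R.graph := by
    cases hr : R.root with
    | none =>
      have := R.isEmpty_of_root_eq_none hr
      exact isScattered_of_isEmpty
    | some r =>
      exact isScattered_of_not_branching R.preconnected R.isAcyclic
        (unbranched_of_mem_rootedClass α R hR r hr)
  exact fun W H hS => ⟨fun e => (hs W H hS).false (e.trans f.symm.toEmbedding)⟩

theorem inClassD_of_isEmpty [IsEmpty V] : InClassD T :=
  ⟨0, emptyTree, emptyTree_mem_rootedClass 0,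
    ⟨⟨Equiv.equivOfIsEmpty PEmpty V, fun {x} => x.elim⟩⟩⟩

theorem topologicallyScattered_of_isEmpty [IsEmpty V] : TopologicallyScattered (Ends T) := by
  rintro S ⟨e, -⟩
  obtain ⟨C, -⟩ := Quotient.exists_rep e
  exact isEmptyElim (C.vertex 0)

end Decomposition

end ScatteredTrees

theorem theorem6 {V : Type u} (T : SimpleGraph V) (hconn : T.Preconnected) (hacyc : T.IsAcyclic) :
    List.TFAE
      [ScatteredTrees.IsScattered T,
       ScatteredTrees.TopologicallyScattered (ScatteredTrees.Ends T),
       ScatteredTrees.InClassD T] := by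
  open ScatteredTrees in
  -- The empty tree has no vertex to serve as `r`, but satisfies all three conditions outright.
  rcases isEmpty_or_nonempty V with _ | ⟨⟨r⟩⟩
  · tfae_have 1 → 2 := fun _ => topologicallyScattered_of_isEmpty
    tfae_have 2 → 3 := fun _ => inClassD_of_isEmpty
    tfae_have 3 → 1 := fun _ => isScattered_of_isEmpty
    tfae_finish
  · tfae_have 1 → 2 := fun h => topologicallyScattered_of_not_branching hconn hacyc
      ((isScattered_iff_not_branching r hconn hacyc).1 h)
    tfae_have 2 → 3 := fun h => inClassD_of_not_branching hconn hacyc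
      (not_branching_of_topologicallyScattered hconn hacyc r h)
    tfae_have 3 → 1 := InClassD.isScattered
    tfae_finish
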